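/- Let $0<\bar\theta<\pi/2$, $\alpha>1$, $x_2(0)<0$, $\dot x_1(0)>0$, $\dot x_2(0)>0$. In $\mathbb R^2$ put $y_1(x)=x_1\cos\bar\theta+x_2\sin\bar\theta$, $y_2(x)=-x_1\sin\bar\theta+x_2\cos\bar\theta$, and $$K=\{x: x_1\le 0,\ y_1(x)\le 0\},\qquad \mathcal R_2=\{x: x_2\ge 0,\ y_2(x)\le 0\},\qquad \mathcal R_3=\{x: y_1(x)\ge 0,\ y_2(x)\ge 0\}.$$ Let $P_K$ be the orthogonal (closest point) projection onto $K$, and let $G(u,v)=\dfrac{(v\cdot(u-P_Ku))\,(u-P_Ku)}{|u-P_Ku|^2}$ if $u\notin K$, $G(u,v)=0$ if $u\in K$. For $k>0$ consider on $[0,\infty)$ the problem $$\ddot u_k+2\alpha\sqrt k\,G(u_k,\dot u_k)+k(u_k-P_Ku_k)=0,\qquad u_k(0)=(0,x_2(0)),\quad \dot u_k(0)=(\dot x_1(0),\dot x_2(0)),\qquad(\ast)$$ where a solution is a continuously differentiable $u_k$ whose velocity satisfies the time-integrated equation. Put $$\Delta=\alpha^2-1,\quad \xi_1=-\alpha+\sqrt\Delta,\quad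 t_0=-\frac{x_2(0)}{\dot x_2(0)},\quad \eta=e^{\xi_1t_0\sqrt k/2},\quad E=\frac{\dot x_1(0)^2\dot x_2(0)^2}{4\Delta},$$ let $R(\tau)=\sqrt k\,\bigl|u_k(t_0+\tau/\sqrt k)\bigr|/\eta$ be the rescaled radius, and let $W=\dot R(0)^2+E/R(0)^2$. Then $(\ast)$ has a solution for all large enough $k$. Moreover there is a constant $C$, depending only on $\bar\theta,\alpha,x_2(0),\dot x_1(0),\dot x_2(0)$, such that for every family $(u_k)$ in which $u_k$ solves $(\ast)$ for all large enough $k$, there are numbers $\bar\tau=\bar\tau(k)$ such that, with $\bar t=t_0+\bar\tau/\sqrt k$, the following holds. (i) For all large enough $k$ and all $t\ge0$: $u_k(t)\in\mathcal R_2$ if and only if $t_0\le t\le\bar t$, and $u_k(t)\in\mathcal R_3$ if and only if $t\ge\bar t$. (ii) As $k\to\infty$, $\bar\tau\sim\tan\bar\theta\,\sqrt E/W$ and $\bar\tau=O(\eta^2)$. (iii) For all large enough $k$ and all $t\ge\bar t$: $0\le y_1(u_k(t))\le C\,e^{\xi_1(t-\bar t)\sqrt k}/\sqrt k$. (iv)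 As $k\to\infty$, $y_2(u_k(t))\sim(t-\bar t)\,\dot x_2(0)\cos\bar\theta$ uniformly in $t\ge\bar t$: for every $\epsilon>0$, for all large enough $k$ and all $t\ge\bar t$, $\bigl|y_2(u_k(t))-(t-\bar t)\dot x_2(0)\cos\bar\theta\bigr|\le\epsilon\,(t-\bar t)\dot x_2(0)\cos\bar\theta$. -/

import Mathlib

open Real Set Filter Topology MeasureTheory Asymptotics

noncomputable section

/-- The Euclidean plane. -/
abbrev Plane : Type := EuclideanSpace ℝ (Fin 2)

/-- First rotated coordinate, along the outer normal of the second side of the cone. -/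
def coordY₁ (θ : ℝ) (x : Plane) : ℝ := x 0 * cos θ + x 1 * sin θ

/-- Second rotated coordinate, along the second side of the cone. -/
def coordY₂ (θ : ℝ) (x : Plane) : ℝ := -(x 0) * sin θ + x 1 * cos θ

/-- The angular domain. -/
def coneK (θ : ℝ) : Set Plane := {x | x 0 ≤ 0 ∧ coordY₁ θ x ≤ 0}

/-- The region of the plane in which the closest point of the cone is the vertex. -/
def region₂ (θ : ℝ) : Set Plane := {x | 0 ≤ x 1 ∧ coordY₂ θ x ≤ 0}

/-- The region of the plane in which the closest point of the cone is on its second side. -/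
def region₃ (θ : ℝ) : Set Plane := {x | 0 ≤ coordY₁ θ x ∧ 0 ≤ coordY₂ θ x}

theorem exists_closest_point_coneK (θ : ℝ) (x : Plane) :
    ∃ p ∈ coneK θ, ∀ z ∈ coneK θ, dist x p ≤ dist x z := by
  have hc : IsClosed (coneK θ) := by
    have h : Continuous fun x : Plane => coordY₁ θ x := by unfold coordY₁; fun_prop
    have h0 : Continuous fun x : Plane => x 0 := by fun_prop
    exact (isClosed_le h0 continuous_const).inter (isClosed_le h continuous_const)
  have hne : (coneK θ).Nonempty := ⟨0, by simp [coneK, coordY₁]⟩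
  obtain ⟨p, hp, h⟩ := hc.exists_infDist_eq_dist hne x
  exact ⟨p, hp, fun z hz => h ▸ Metric.infDist_le_dist_of_mem hz⟩

/-- The projection onto the cone: the point of the (closed, convex) cone closest to `x`. -/
def projK (θ : ℝ) (x : Plane) : Plane := (exists_closest_point_coneK θ x).choose

open Classical in
/-- The damping direction `G(u, v)`: the component of the velocity along `u - P_K u`. -/
def dampG (θ : ℝ) (u v : Plane) : Plane :=
  if u ∈ coneK θ then 0
  else (inner ℝ v (u - projK θ u) / ‖u - projK θ u‖ ^ 2) • (u - projK θ u)

/-- The force `2 α √k G(u, v) + k (u - P_K u)` of the penalized equation. -/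
def penaltyForce (θ α k : ℝ) (u v : Plane) : Plane :=
  (2 * α * √k) • dampG θ u v + k • (u - projK θ u)

/-- `u` is a solution on `[0, ∞)` of `u'' + 2 α √k G(u, u') + k (u - P_K u) = 0` with
`u(0) = (0, x₂₀)` and `u'(0) = (v₁₀, v₂₀)`. Since `G` is discontinuous across the boundary of
the cone (where the motion starts), the equation is understood in the sense of Carathéodory:
`u` is continuously differentiable and its velocity `v` satisfies the integrated equation. -/
def IsPenalizedMotion (θ α x₂₀ v₁₀ v₂₀ k : ℝ) (u : ℝ → Plane) : Prop :=
  u 0 = !₂[0, x₂₀] ∧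
  ∃ v : ℝ → Plane,
    ContinuousOn v (Ici 0) ∧
    (∀ t, 0 ≤ t → HasDerivWithinAt u (v t) (Ici 0) t) ∧
    ∀ t, 0 ≤ t →
      IntervalIntegrable (fun s => penaltyForce θ α k (u s) (v s)) volume 0 t ∧
      v t = !₂[v₁₀, v₂₀] - ∫ s in (0 : ℝ)..t, penaltyForce θ α k (u s) (v s)

/-- The larger root of `ξ² + 2 α ξ + 1 = 0`. -/
def xi₁ (α : ℝ) : ℝ := -α + √(α ^ 2 - 1)

/-- The time at which the free tangential motion along the first side reaches the corner. -/
def cornerTime (x₂₀ v₂₀ : ℝ) : ℝ := -x₂₀ / v₂₀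

/-- The small scale `η`. -/
def etaScale (α x₂₀ v₂₀ k : ℝ) : ℝ := exp (xi₁ α * cornerTime x₂₀ v₂₀ * √k / 2)

/-- The constant `E`. -/
def constE (α v₁₀ v₂₀ : ℝ) : ℝ := v₁₀ ^ 2 * v₂₀ ^ 2 / (4 * (α ^ 2 - 1))

/-- The scaled radius `R(τ)`, given by `|u(t)| = η R(τ) / √k` with `t = t₀ + τ / √k`. -/
def scaledRadius (α x₂₀ v₂₀ k : ℝ) (u : ℝ → Plane) (τ : ℝ) : ℝ :=
  √k * ‖u (cornerTime x₂₀ v₂₀ + τ / √k)‖ / etaScale α x₂₀ v₂₀ k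

/-- The quantity `W = R'(0)² + E / R(0)²`. -/
def energyW (α x₂₀ v₁₀ v₂₀ k : ℝ) (u : ℝ → Plane) : ℝ :=
  deriv (scaledRadius α x₂₀ v₂₀ k u) 0 ^ 2
    + constE α v₁₀ v₂₀ / scaledRadius α x₂₀ v₂₀ k u 0 ^ 2

end

/-!
Over a side of the cone the penalty force acts along the normal of that side only, so there the
motion splits into a free tangential motion and an overdamped normal oscillation with rates `ξ₁ √k`
and `ξ₂ √k`. At time `t₀` the motion therefore reaches the half-line separating the first side
from the vertex region at a distance `X` from the vertex with `√k X ≈ c η²`,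
`c = v₁₀ / (ξ₁ - ξ₂)`, with normal velocity `D → 0` and tangential velocity `v₂₀`. The whole vertex
region at that distance is crossed in a time of order `X`, which `√k X → 0` makes so short that the
force hardly changes the velocity: the motion is free up to a relative error `ρ → 0`, and it leaves
the region at a time `T` with `T - t₀ ≈ X tan θ / v₂₀`. As `W η² → v₂₀²` and `√E = c v₂₀`, this is
the asserted asymptotics of `√k (T - t₀)`. After `T` the motion is again explicit.

The force is discontinuous only across the boundary of the cone. Existence follows by gluing the
explicit motions over the two sides to a Picard-Lindelöf motion over the vertex, where the force is
smooth away from the vertex itself. For uniqueness, the explicit motions enter the interior of the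
region of their side at once and stay there, and the force extends from that region to a globally
Lipschitz one; so every motion coincides with the explicit one for as long as the latter stays.
-/

noncomputable section

section Motion

variable {E : Type*} [NormedAddCommGroup E] [NormedSpace ℝ E] {F G : E → E → E} {I J : Set ℝ}
  {u v p w : ℝ → E} {a b c d : ℝ}

/-- `u` moves on the set of times `I` with velocity `v` under the law `u'' = -F(u, u')`. The law
is imposed in integrated form between any two times of `I`, so that `F` may be discontinuous. -/
structure IsMotionOn (F : E → E → E) (I : Set ℝ) (u v : ℝ → E) : Prop where
  continuousOn_vel : ContinuousOn v I
  hasDerivWithinAt : ∀ t ∈ I, HasDerivWithinAt u (v t) I t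
  intervalIntegrable : ∀ s ∈ I, ∀ t ∈ I, IntervalIntegrable (fun r => F (u r) (v r)) volume s t
  vel_eq : ∀ s ∈ I, ∀ t ∈ I, v t = v s - ∫ r in s..t, F (u r) (v r)

namespace IsMotionOn

theorem of_base (a : ℝ) (hv : ContinuousOn v I)
    (hu : ∀ t ∈ I, HasDerivWithinAt u (v t) I t)
    (hint : ∀ t ∈ I, IntervalIntegrable (fun r => F (u r) (v r)) volume a t)
    (heq : ∀ t ∈ I, v t = v a - ∫ r in a..t, F (u r) (v r)) : IsMotionOn F I u v where
  continuousOn_vel := hv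
  hasDerivWithinAt := hu
  intervalIntegrable s hs t ht := (hint s hs).symm.trans (hint t ht)
  vel_eq s hs t ht := by
    rw [heq s hs, heq t ht, ← intervalIntegral.integral_add_adjacent_intervals (hint s hs)
      ((hint s hs).symm.trans (hint t ht))]
    abel

theorem mono (h : IsMotionOn F I u v) (hJ : J ⊆ I) : IsMotionOn F J u v where
  continuousOn_vel := h.continuousOn_vel.mono hJ
  hasDerivWithinAt t ht := (h.hasDerivWithinAt t (hJ ht)).mono hJ
  intervalIntegrable s hs t ht := h.intervalIntegrable s (hJ hs) t (hJ ht)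
  vel_eq s hs t ht := h.vel_eq s (hJ hs) t (hJ ht)

theorem continuousOn_pos (h : IsMotionOn F I u v) : ContinuousOn u I :=
  fun t ht => (h.hasDerivWithinAt t ht).continuousWithinAt

theorem hasDerivWithinAt_Ici (h : IsMotionOn F (Icc a b) u v) :
    ∀ t ∈ Ico a b, HasDerivWithinAt u (v t) (Ici t) t := fun t ht =>
  (h.hasDerivWithinAt t (Ico_subset_Icc_self ht)).mono_of_mem_nhdsWithin
    (mem_of_superset (Icc_mem_nhdsGE ht.2) (Icc_subset_Icc_left ht.1))

theorem congr_force (h : IsMotionOn F I u v) (hI : OrdConnected I)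
    (hFG : ∀ t ∈ interior I, F (u t) (v t) = G (u t) (v t)) : IsMotionOn G I u v := by
  have hEqOn : ∀ s ∈ I, ∀ t ∈ I,
      EqOn (fun r => F (u r) (v r)) (fun r => G (u r) (v r)) (uIoo s t) := fun s hs t ht r hr =>
    hFG r (interior_maximal (uIoo_subset_uIcc_self.trans (hI.uIcc_subset hs ht)) isOpen_Ioo hr)
  refine ⟨h.continuousOn_vel, h.hasDerivWithinAt, fun s hs t ht => ?_, fun s hs t ht => ?_⟩
  · exact (h.intervalIntegrable s hs t ht).congr_uIoo (hEqOn s hs t ht)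
  · rw [h.vel_eq s hs t ht, intervalIntegral.integral_congr_uIoo (hEqOn s hs t ht)]

theorem congr (h : IsMotionOn F I u v) (hI : OrdConnected I) (hp : EqOn p u I) (hw : EqOn w v I) :
    IsMotionOn F I p w := by
  have hEqOn : ∀ s ∈ I, ∀ t ∈ I,
      EqOn (fun r => F (u r) (v r)) (fun r => F (p r) (w r)) (uIoo s t) := fun s hs t ht r hr => by
    have hrI := hI.uIcc_subset hs ht (uIoo_subset_uIcc_self hr)
    simp only [hp hrI, hw hrI]
  refine ⟨h.continuousOn_vel.congr hw, fun t ht => ?_, fun s hs t ht => ?_, fun s hs t ht => ?_⟩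
  · rw [hw ht]
    exact (h.hasDerivWithinAt t ht).congr hp (hp ht)
  · exact (h.intervalIntegrable s hs t ht).congr_uIoo (hEqOn s hs t ht)
  · rw [hw hs, hw ht, h.vel_eq s hs t ht,
      intervalIntegral.integral_congr_uIoo (hEqOn s hs t ht)]

theorem union (hI : IsClosed I) (hJ : IsClosed J) (hcI : c ∈ I) (hcJ : c ∈ J)
    (h₁ : IsMotionOn F I u v) (h₂ : IsMotionOn F J u v) : IsMotionOn F (I ∪ J) u v := by
  have hderiv : ∀ {S : Set ℝ}, IsClosed S → IsMotionOn F S u v →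
      ∀ t, HasDerivWithinAt u (v t) S t := fun {S} hS h t => by
    by_cases ht : t ∈ S
    · exact h.hasDerivWithinAt t ht
    · exact hasDerivWithinAt_iff_hasFDerivWithinAt.2
        (.of_notMem_closure (by rwa [hS.closure_eq]))
  refine of_base c
    (h₁.continuousOn_vel.union_of_isClosed h₂.continuousOn_vel hI hJ)
    (fun t _ => (hderiv hI h₁ t).union (hderiv hJ h₂ t)) ?_ ?_
  · rintro t (ht | ht)
    exacts [h₁.intervalIntegrable c hcI t ht, h₂.intervalIntegrable c hcJ t ht]
  · rintro t (ht | ht)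
    exacts [h₁.vel_eq c hcI t ht, h₂.vel_eq c hcJ t ht]

theorem exists_concat (hac : a ≤ c) (h₁ : IsMotionOn F (Icc a c) u v)
    (h₂ : IsMotionOn F (Ici c) p w) (hpos : u c = p c) (hvel : v c = w c) :
    ∃ u' v' : ℝ → E, u' a = u a ∧ v' a = v a ∧ IsMotionOn F (Ici a) u' v' := by
  have hleft : ∀ f g : ℝ → E, EqOn ((Iic c).piecewise f g) f (Icc a c) := fun f g t ht =>
    piecewise_eq_of_mem _ _ _ ht.2
  have hright : ∀ {f g : ℝ → E}, f c = g c → EqOn ((Iic c).piecewise f g) g (Ici c) :=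
    fun {f g} hfg t ht => by
      rcases (mem_Ici.1 ht).eq_or_lt with rfl | hct
      · rw [piecewise_eq_of_mem _ _ _ self_mem_Iic, hfg]
      · exact piecewise_eq_of_notMem _ _ _ (notMem_Iic.2 hct)
  refine ⟨(Iic c).piecewise u p, (Iic c).piecewise v w, hleft u p ⟨le_rfl, hac⟩,
    hleft v w ⟨le_rfl, hac⟩, ?_⟩
  rw [← Icc_union_Ici_eq_Ici hac]
  exact union isClosed_Icc isClosed_Ici ⟨hac, le_rfl⟩ self_mem_Ici
    (h₁.congr ordConnected_Icc (hleft u p) (hleft v w))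
    (h₂.congr ordConnected_Ici (hright hpos) (hright hvel))

section Complete

variable [CompleteSpace E]

theorem of_hasDerivWithinAt (hI : OrdConnected I) (hF : Continuous (Function.uncurry F))
    (hu : ∀ t ∈ I, HasDerivWithinAt u (v t) I t)
    (hv : ∀ t ∈ I, HasDerivWithinAt v (-F (u t) (v t)) I t) : IsMotionOn F I u v := by
  have hcv : ContinuousOn v I := fun t ht => (hv t ht).continuousWithinAt
  have hcu : ContinuousOn u I := fun t ht => (hu t ht).continuousWithinAt
  have hcF : ContinuousOn (fun t => F (u t) (v t)) I := hF.comp_continuousOn (hcu.prodMk hcv)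
  have hint : ∀ s ∈ I, ∀ t ∈ I, IntervalIntegrable (fun r => F (u r) (v r)) volume s t :=
    fun s hs t ht => (hcF.mono (hI.uIcc_subset hs ht)).intervalIntegrable
  refine ⟨hcv, hu, hint, fun s hs t ht => ?_⟩
  have hsub : uIcc s t ⊆ I := hI.uIcc_subset hs ht
  have hftc := intervalIntegral.integral_eq_sub_of_hasDeriv_right (hcv.mono hsub)
    (fun r hr => ((hv r (hsub (Ioo_subset_Icc_self hr))).hasDerivAt (mem_of_superset
      (Ioo_mem_nhds hr.1 hr.2) (Ioo_subset_Icc_self.trans hsub))).hasDerivWithinAt)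
    (hint s hs t ht).neg
  rw [intervalIntegral.integral_neg] at hftc
  rw [sub_eq_add_neg, hftc, add_sub_cancel]

theorem hasDerivWithinAt_vel (h : IsMotionOn F (Icc a b) u v)
    (hF : Continuous (Function.uncurry F)) :
    ∀ t ∈ Icc a b, HasDerivWithinAt v (-F (u t) (v t)) (Icc a b) t := by
  intro t ht
  have hab : a ≤ b := ht.1.trans ht.2
  have hcF : ContinuousOn (fun t => F (u t) (v t)) (Icc a b) :=
    hF.comp_continuousOn (h.continuousOn_pos.prodMk h.continuousOn_vel)
  have : Fact (t ∈ Icc a b) := ⟨ht⟩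
  exact ((intervalIntegral.integral_hasDerivWithinAt_right
    (h.intervalIntegrable a (left_mem_Icc.2 hab) t ht)
    (hcF.stronglyMeasurableAtFilter_nhdsWithin measurableSet_Icc t) (hcF t ht)).const_sub
      (v a)).congr (h.vel_eq a (left_mem_Icc.2 hab)) (h.vel_eq a (left_mem_Icc.2 hab) t ht)

theorem eqOn_of_lipschitzWith {K : NNReal} (hF : LipschitzWith K (Function.uncurry F))
    (h₁ : IsMotionOn F (Icc a b) u v) (h₂ : IsMotionOn F (Icc a b) p w) (hpos : u a = p a)
    (hvel : v a = w a) : EqOn u p (Icc a b) ∧ EqOn v w (Icc a b) := by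
  have hfield : LipschitzWith (max 1 K) fun z : E × E => (z.2, -Function.uncurry F z) :=
    LipschitzWith.prod_snd.prodMk hF.neg
  have hderiv : ∀ {u v : ℝ → E}, IsMotionOn F (Icc a b) u v → ∀ t ∈ Ico a b,
      HasDerivWithinAt (fun t => (u t, v t)) (v t, -F (u t) (v t)) (Ici t) t :=
    fun h t ht => (h.hasDerivWithinAt_Ici t ht).prodMk
      ((h.hasDerivWithinAt_vel hF.continuous t (Ico_subset_Icc_self ht)).mono_of_mem_nhdsWithin
        (mem_of_superset (Icc_mem_nhdsGE ht.2) (Icc_subset_Icc_left ht.1)))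
  have hEqOn := ODE_solution_unique_of_mem_Icc_right (s := fun _ => univ)
    (fun _ _ => hfield.lipschitzOnWith) (h₁.continuousOn_pos.prodMk h₁.continuousOn_vel)
    (hderiv h₁) (fun _ _ => mem_univ _) (h₂.continuousOn_pos.prodMk h₂.continuousOn_vel)
    (hderiv h₂) (fun _ _ => mem_univ _) (Prod.ext hpos hvel)
  exact ⟨fun t ht => congrArg Prod.fst (hEqOn ht), fun t ht => congrArg Prod.snd (hEqOn ht)⟩

theorem eqOn_of_forall_mem {K : NNReal} {U : Set E} (hFG : ∀ x ∈ U, ∀ y, F x y = G x y)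
    (hG : LipschitzWith K (Function.uncurry G)) (hF_motion : IsMotionOn F (Icc a b) u v)
    (hG_motion : IsMotionOn G (Icc a b) p w) (hpos : u a = p a) (hvel : v a = w a)
    (hU : ∀ t ∈ Ioo a b, u t ∈ U) : EqOn u p (Icc a b) ∧ EqOn v w (Icc a b) :=
  (hF_motion.congr_force ordConnected_Icc fun t ht =>
    hFG _ (hU t (by rwa [interior_Icc] at ht)) _).eqOn_of_lipschitzWith hG hG_motion hpos hvel

-- A continuity argument: the two motions agree on a closed set of times, and agreement at a time
-- before `d` puts `u` in `U` for a while, where uniqueness for `G` applies.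
theorem eqOn_of_eventually_mem {K : NNReal} {U : Set E} (hU : IsOpen U)
    (hFG : ∀ x ∈ U, ∀ y, F x y = G x y) (hG : LipschitzWith K (Function.uncurry G))
    (hF_motion : IsMotionOn F (Icc c d) u v) (hG_motion : IsMotionOn G (Icc c d) p w)
    (hpos : u c = p c) (hvel : v c = w c) (hstart : ∀ᶠ t in 𝓝[>] c, u t ∈ U)
    (hstay : ∀ t ∈ Ioo c d, p t ∈ U) : EqOn u p (Icc c d) ∧ EqOn v w (Icc c d) := by
  have hclosed : IsClosed ({t | (u t, v t) = (p t, w t)} ∩ Icc c d) := by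
    rw [inter_comm]
    exact ((hF_motion.continuousOn_pos.prodMk hF_motion.continuousOn_vel).prodMk
      (hG_motion.continuousOn_pos.prodMk
        hG_motion.continuousOn_vel)).preimage_isClosed_of_isClosed isClosed_Icc isClosed_diagonal
  have hsub : Icc c d ⊆ {t | (u t, v t) = (p t, w t)} := by
    refine hclosed.Icc_subset_of_forall_exists_gt (Prod.ext hpos hvel) ?_
    rintro x ⟨hx, hcx, hxd⟩ y hxy
    obtain ⟨hux, hvx⟩ : u x = p x ∧ v x = w x := Prod.mk.inj hx
    have hevent : ∀ᶠ t in 𝓝[>] x, u t ∈ U := by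
      rcases hcx.eq_or_lt with rfl | hlt
      · exact hstart
      · exact (((hF_motion.hasDerivWithinAt_Ici x ⟨hcx, hxd⟩).continuousWithinAt).mono
          Ioi_subset_Ici_self).eventually (hU.mem_nhds (by rw [hux]; exact hstay x ⟨hlt, hxd⟩))
    obtain ⟨z, hxz, hz⟩ := mem_nhdsGT_iff_exists_Ioo_subset.1 hevent
    set m := min z (min y d)
    have hxm : x < m := lt_min hxz (lt_min hxy hxd)
    have hmz : m ≤ z := min_le_left _ _
    have hmy : m ≤ y := (min_le_right _ _).trans (min_le_left _ _)
    have hmd : m ≤ d := (min_le_right _ _).trans (min_le_right _ _)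
    have hIcc : Icc x m ⊆ Icc c d := Icc_subset_Icc hcx hmd
    obtain ⟨hu_eq, hv_eq⟩ := (hF_motion.mono hIcc).eqOn_of_forall_mem hFG hG (hG_motion.mono hIcc)
      hux hvx fun t ht => hz ⟨ht.1, ht.2.trans_le hmz⟩
    have hm : m ∈ Icc x m := ⟨hxm.le, le_rfl⟩
    exact ⟨m, Prod.ext (hu_eq hm) (hv_eq hm), hxm, hmy⟩
  exact ⟨fun t ht => congrArg Prod.fst (hsub ht), fun t ht => congrArg Prod.snd (hsub ht)⟩

end Complete

end IsMotionOn

/-- The force `F` grows at most linearly, at rate `c` in the velocity and `k` in the position. -/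
def HasLinearGrowth (F : E → E → E) (c k : ℝ) : Prop :=
  ∀ x y, ‖F x y‖ ≤ c * ‖y‖ + k * ‖x‖

/-- The bound of `IsMotionOn.norm_vel_sub_le` on the change of velocity during a time `h` of a
motion starting at distance at most `r` from the origin with speed at most `s`. -/
def driftBound (c k h r s : ℝ) : ℝ :=
  h * ((c + k * h) * (2 * (s + h * (k * r))) + k * r)

theorem IsMotionOn.norm_vel_sub_le {k : ℝ} (hF : HasLinearGrowth F c k) (hc : 0 ≤ c) (hk : 0 ≤ k)
    (h : IsMotionOn F (Icc a b) u v) (hsmall : (b - a) * (c + k * (b - a)) ≤ 1 / 2) {t : ℝ}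
    (ht : t ∈ Icc a b) : ‖v t - v a‖ ≤ driftBound c k (b - a) ‖u a‖ ‖v a‖ := by
  have hab : 0 ≤ b - a := sub_nonneg.2 (ht.1.trans ht.2)
  have ha : a ∈ Icc a b := left_mem_Icc.2 (ht.1.trans ht.2)
  obtain ⟨s₀, hs₀, hmax⟩ := isCompact_Icc.exists_isMaxOn ⟨a, ha⟩ h.continuousOn_vel.norm
  set m := ‖v s₀‖
  have hm : 0 ≤ m := norm_nonneg _
  have hpos : ∀ s ∈ Icc a b, ‖u s‖ ≤ ‖u a‖ + m * (b - a) := fun s hs =>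
    calc ‖u s‖ ≤ ‖u a‖ + ‖u s - u a‖ := norm_le_norm_add_norm_sub' _ _
      _ ≤ ‖u a‖ + m * (s - a) := by
        gcongr
        exact norm_image_sub_le_of_norm_deriv_le_segment' h.hasDerivWithinAt
          (fun r hr => hmax (Ico_subset_Icc_self hr)) s hs
      _ ≤ ‖u a‖ + m * (b - a) := by gcongr; exact hs.2
  have hvel : ∀ s ∈ Icc a b, ‖v s - v a‖ ≤ (b - a) * ((c + k * (b - a)) * m + k * ‖u a‖) := by
    intro s hs
    rw [h.vel_eq a ha s hs, sub_sub_cancel_left, norm_neg]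
    calc ‖∫ r in a..s, F (u r) (v r)‖
      _ ≤ (c * m + k * (‖u a‖ + m * (b - a))) * |s - a| := by
        refine intervalIntegral.norm_integral_le_of_norm_le_const fun r hr => ?_
        rw [uIoc_of_le hs.1] at hr
        have hr' : r ∈ Icc a b := ⟨hr.1.le, hr.2.trans hs.2⟩
        refine (hF _ _).trans ?_
        gcongr
        exacts [hmax hr', hpos r hr']
      _ ≤ (c * m + k * (‖u a‖ + m * (b - a))) * (b - a) := by
        rw [abs_of_nonneg (sub_nonneg.2 hs.1)]
        gcongr
        exact hs.2
      _ = _ := by ring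
  have hm_le : m ≤ 2 * (‖v a‖ + (b - a) * (k * ‖u a‖)) := by
    have htri : m ≤ ‖v a‖ + ‖v s₀ - v a‖ := norm_le_norm_add_norm_sub' _ _
    have hhalf := mul_le_mul_of_nonneg_right hsmall hm
    linarith [hvel s₀ hs₀]
  refine (hvel t ht).trans ?_
  unfold driftBound
  gcongr

theorem driftBound_mono {k h r s r' s' : ℝ} (hc : 0 ≤ c) (hk : 0 ≤ k) (hh : 0 ≤ h) (hr : r ≤ r')
    (hs : s ≤ s') : driftBound c k h r s ≤ driftBound c k h r' s' := by
  unfold driftBound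
  gcongr

theorem exists_isMotionOn_of_lipschitzOnWith [CompleteSpace E] {k h : ℝ} {K : NNReal} {x y : E}
    (hF : HasLinearGrowth F c k) (hF_cont : Continuous (Function.uncurry F)) (hc : 0 ≤ c)
    (hk : 0 ≤ k) (hh : 0 ≤ h)
    (hF_lip : LipschitzOnWith K (Function.uncurry F) (Metric.closedBall (x, y) 1))
    (hsmall : (‖y‖ + 1 + (c * (‖y‖ + 1) + k * (‖x‖ + 1))) * h ≤ 1) (a : ℝ) :
    ∃ u v : ℝ → E, u a = x ∧ v a = y ∧ IsMotionOn F (Icc a (a + h)) u v := by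
  set field : E × E → E × E := fun z => (z.2, -Function.uncurry F z)
  set L : ℝ := ‖y‖ + 1 + (c * (‖y‖ + 1) + k * (‖x‖ + 1))
  have hL_nonneg : 0 ≤ L := by positivity
  have hfield_lip : LipschitzOnWith (max 1 K) field (Metric.closedBall (x, y) 1) :=
    LipschitzWith.prod_snd.lipschitzOnWith.prodMk hF_lip.neg
  have hfield_norm : ∀ z ∈ Metric.closedBall (x, y) 1, ‖field z‖ ≤ L := by
    intro z hz
    rw [mem_closedBall_iff_norm] at hz
    have hz₁ : ‖z.1‖ ≤ ‖x‖ + 1 :=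
      norm_le_norm_add_const_of_dist_le ((dist_eq_norm _ _).trans_le ((norm_fst_le _).trans hz))
    have hz₂ : ‖z.2‖ ≤ ‖y‖ + 1 :=
      norm_le_norm_add_const_of_dist_le ((dist_eq_norm _ _).trans_le ((norm_snd_le _).trans hz))
    have hforce : ‖-F z.1 z.2‖ ≤ c * (‖y‖ + 1) + k * (‖x‖ + 1) := by
      rw [norm_neg]
      exact (hF _ _).trans (by gcongr)
    refine norm_prod_le_iff.2 ⟨hz₂.trans ?_, hforce.trans ?_⟩
    · exact le_add_of_nonneg_right (by positivity)
    · exact le_add_of_nonneg_left (by positivity)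
  have hPL : IsPicardLindelof (fun _ => field) (tmin := a) (tmax := a + h)
      ⟨a, le_rfl, le_add_of_nonneg_right hh⟩ (x, y) 1 0 ⟨L, hL_nonneg⟩ (max 1 K) :=
    .of_time_independent hfield_norm hfield_lip (by
      rw [add_sub_cancel_left, sub_self, max_eq_left hh, NNReal.coe_zero, sub_zero]
      exact hsmall)
  obtain ⟨z, hz₀, hz⟩ := hPL.exists_eq_forall_mem_Icc_hasDerivWithinAt₀
  refine ⟨fun t => (z t).1, fun t => (z t).2, congrArg Prod.fst hz₀, congrArg Prod.snd hz₀,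
    .of_hasDerivWithinAt ordConnected_Icc hF_cont (fun t ht => ?_) fun t ht => ?_⟩
  · exact (ContinuousLinearMap.fst ℝ E E).hasFDerivAt.comp_hasDerivWithinAt t (hz t ht)
  · exact (ContinuousLinearMap.snd ℝ E E).hasFDerivAt.comp_hasDerivWithinAt t (hz t ht)

theorem norm_sub_sub_smul_le {y : E} {ρ t : ℝ}
    (hu : ∀ s ∈ Icc a b, HasDerivWithinAt u (v s) (Icc a b) s)
    (hv : ∀ s ∈ Icc a b, ‖v s - y‖ ≤ ρ) (ht : t ∈ Icc a b) :
    ‖u t - u a - (t - a) • y‖ ≤ ρ * (t - a) := by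
  have hderiv : ∀ s ∈ Icc a b,
      HasDerivWithinAt (fun s => u s - (s - a) • y) (v s - y) (Icc a b) s := fun s hs =>
    (hu s hs).fun_sub (by
      simpa using (((hasDerivAt_id s).sub_const a).smul_const y).hasDerivWithinAt)
  have hle := norm_image_sub_le_of_norm_deriv_le_segment' hderiv
    (fun s hs => hv s (Ico_subset_Icc_self hs)) t ht
  rwa [sub_self, zero_smul, sub_zero, sub_right_comm] at hle

end Motion

theorem eventually_pos_of_hasDerivWithinAt {f : ℝ → ℝ} {f' c : ℝ}
    (hf : HasDerivWithinAt f f' (Ici c) c) (hf' : 0 < f') (hc : f c = 0) :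
    ∀ᶠ t in 𝓝[>] c, 0 < f t := by
  have hslope := (hasDerivWithinAt_iff_tendsto_slope' self_notMem_Ioi).1
    (hf.mono Ioi_subset_Ici_self)
  filter_upwards [hslope.eventually (lt_mem_nhds hf'), self_mem_nhdsWithin] with t ht hct
  rw [slope_def_field, hc, sub_zero] at ht
  exact (div_pos_iff_of_pos_right (sub_pos.2 hct)).1 ht

section InnerProduct

variable {V : Type*} [NormedAddCommGroup V] [InnerProductSpace ℝ V]

theorem eq_of_norm_sub_le_of_inner_nonpos {u p q : V} (hle : ‖u - p‖ ≤ ‖u - q‖)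
    (hinner : inner ℝ (u - q) (p - q) ≤ 0) : p = q := by
  have hexpand : ‖u - p‖ ^ 2 = ‖u - q‖ ^ 2 - 2 * inner ℝ (u - q) (p - q) + ‖p - q‖ ^ 2 := by
    rw [← norm_sub_sq_real, sub_sub_sub_cancel_right]
  have hsq : ‖p - q‖ ^ 2 ≤ 0 := by
    have : ‖u - p‖ ^ 2 ≤ ‖u - q‖ ^ 2 := by gcongr
    linarith
  have hnorm : ‖p - q‖ = 0 := pow_eq_zero_iff two_ne_zero |>.1 (hsq.antisymm (sq_nonneg _))
  exact sub_eq_zero.1 (norm_eq_zero.1 hnorm)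

/-- The orthogonal projection of `v` onto the line spanned by `e`, which is `0` if `e = 0`. -/
def radialPart (e v : V) : V := (inner ℝ v e / ‖e‖ ^ 2) • e

theorem norm_radialPart_le (e v : V) : ‖radialPart e v‖ ≤ ‖v‖ := by
  have hproj := Submodule.starProjection_singleton ℝ (v := e) (w := v)
  rw [real_inner_comm] at hproj
  exact (congrArg norm hproj).symm.trans_le (Submodule.norm_starProjection_apply_le _ v)

theorem radialPart_smul {c : ℝ} (hc : c ≠ 0) (e v : V) : radialPart (c • e) v = radialPart e v := by
  unfold radialPart
  rw [norm_smul, real_inner_smul_right, norm_eq_abs, mul_pow, sq_abs, smul_smul]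
  congr 1
  rcases eq_or_ne ‖e‖ 0 with he | he
  · simp [he]
  · field_simp

theorem contDiffAt_radialPart {z : V × V} (hz : z.1 ≠ 0) :
    ContDiffAt ℝ 1 (fun z : V × V => radialPart z.1 z.2) z :=
  ((contDiffAt_snd.inner ℝ contDiffAt_fst).div (contDiff_fst.norm_sq ℝ).contDiffAt
    (pow_ne_zero 2 (norm_ne_zero_iff.2 hz))).smul contDiffAt_fst

/-- The force of a spring of stiffness `k` extended by `x`, with damping of coefficient `2 α √k`
acting on the component of the velocity `v` along `e`. -/
def dampedSpring (α k : ℝ) (e x v : V) : V := (2 * α * √k) • radialPart e v + k • x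

theorem norm_dampedSpring_le {α k : ℝ} (hα : 0 ≤ α) (hk : 0 ≤ k) (e x v : V) :
    ‖dampedSpring α k e x v‖ ≤ 2 * α * √k * ‖v‖ + k * ‖x‖ := by
  refine (norm_add_le _ _).trans ?_
  rw [norm_smul, norm_smul, norm_of_nonneg hk, norm_of_nonneg (by positivity)]
  gcongr
  exact norm_radialPart_le e v

end InnerProduct

/-- The unit vector at angle `φ` from the first axis. -/
def unitVec (φ : ℝ) : Plane := !₂[cos φ, sin φ]

theorem plane_inner_eq (x y : Plane) : inner ℝ x y = x 0 * y 0 + x 1 * y 1 := by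
  simp [PiLp.inner_apply, Fin.sum_univ_two, mul_comm]

theorem plane_norm_sq_eq (x : Plane) : ‖x‖ ^ 2 = x 0 ^ 2 + x 1 ^ 2 := by
  simp [EuclideanSpace.norm_sq_eq, Fin.sum_univ_two]

theorem norm_unitVec (φ : ℝ) : ‖unitVec φ‖ = 1 := by
  rw [← sq_eq_sq₀ (norm_nonneg _) zero_le_one, plane_norm_sq_eq]
  simp [unitVec]

section Coordinates

variable {φ t : ℝ} {u : ℝ → Plane} {v : Plane} {s : Set ℝ}

theorem inner_unitVec (φ : ℝ) (x : Plane) : inner ℝ (unitVec φ) x = coordY₁ φ x := by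
  simp [plane_inner_eq, unitVec, coordY₁, mul_comm]

theorem coordY₁_add_pi_div_two (φ : ℝ) (x : Plane) : coordY₁ (φ + π / 2) x = coordY₂ φ x := by
  simp [coordY₁, coordY₂, cos_add_pi_div_two, sin_add_pi_div_two]

@[simp] theorem coordY₁_zero_left (x : Plane) : coordY₁ 0 x = x 0 := by simp [coordY₁]

@[simp] theorem coordY₂_zero_left (x : Plane) : coordY₂ 0 x = x 1 := by simp [coordY₂]

theorem coordY₁_add (φ : ℝ) (x y : Plane) : coordY₁ φ (x + y) = coordY₁ φ x + coordY₁ φ y := by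
  simp only [← inner_unitVec, inner_add_right]

theorem coordY₂_add (φ : ℝ) (x y : Plane) : coordY₂ φ (x + y) = coordY₂ φ x + coordY₂ φ y := by
  simp only [← coordY₁_add_pi_div_two, coordY₁_add]

theorem coordY₁_sub (φ : ℝ) (x y : Plane) : coordY₁ φ (x - y) = coordY₁ φ x - coordY₁ φ y := by
  simp only [← inner_unitVec, inner_sub_right]

theorem coordY₁_smul (φ c : ℝ) (x : Plane) : coordY₁ φ (c • x) = c * coordY₁ φ x := by
  simp only [← inner_unitVec, real_inner_smul_right]

theorem coordY₂_smul (φ c : ℝ) (x : Plane) : coordY₂ φ (c • x) = c * coordY₂ φ x := by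
  simp only [← coordY₁_add_pi_div_two, coordY₁_smul]

@[simp] theorem coordY₁_unitVec (φ : ℝ) : coordY₁ φ (unitVec φ) = 1 := by
  rw [← inner_unitVec, real_inner_self_eq_norm_sq, norm_unitVec, one_pow]

@[simp] theorem coordY₂_unitVec (φ : ℝ) : coordY₂ φ (unitVec φ) = 0 := by
  simp only [coordY₂, unitVec, Matrix.cons_val_zero, Matrix.cons_val_one]
  ring

theorem abs_coordY₁_le (φ : ℝ) (x : Plane) : |coordY₁ φ x| ≤ ‖x‖ := by
  simpa [inner_unitVec, norm_unitVec] using abs_real_inner_le_norm (unitVec φ) x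

theorem continuous_coordY₁ (φ : ℝ) : Continuous (coordY₁ φ) :=
  (innerSL ℝ (unitVec φ)).continuous.congr (inner_unitVec φ)

theorem continuous_coordY₂ (φ : ℝ) : Continuous (coordY₂ φ) :=
  (continuous_coordY₁ _).congr (coordY₁_add_pi_div_two φ)

theorem hasDerivWithinAt_coordY₁ (h : HasDerivWithinAt u v s t) :
    HasDerivWithinAt (fun t => coordY₁ φ (u t)) (coordY₁ φ v) s t := by
  simpa only [← inner_unitVec, innerSL_apply_apply, Function.comp_def] using
    (innerSL ℝ (unitVec φ)).hasFDerivAt.comp_hasDerivWithinAt t h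

theorem hasDerivWithinAt_coordY₂ (h : HasDerivWithinAt u v s t) :
    HasDerivWithinAt (fun t => coordY₂ φ (u t)) (coordY₂ φ v) s t := by
  simpa only [coordY₁_add_pi_div_two] using hasDerivWithinAt_coordY₁ (φ := φ + π / 2) h

end Coordinates

section Projection

variable {θ α k : ℝ} {u : Plane}

theorem zero_mem_coneK (θ : ℝ) : (0 : Plane) ∈ coneK θ := by simp [coneK, coordY₁]

theorem projK_mem (θ : ℝ) (u : Plane) : projK θ u ∈ coneK θ :=
  (exists_closest_point_coneK θ u).choose_spec.1

theorem norm_sub_projK_le {z : Plane} (hz : z ∈ coneK θ) (u : Plane) :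
    ‖u - projK θ u‖ ≤ ‖u - z‖ := by
  rw [← dist_eq_norm, ← dist_eq_norm]
  exact (exists_closest_point_coneK θ u).choose_spec.2 z hz

theorem projK_eq_of_inner_nonpos {q : Plane} (hq : q ∈ coneK θ)
    (h : ∀ z ∈ coneK θ, inner ℝ (u - q) (z - q) ≤ 0) : projK θ u = q :=
  eq_of_norm_sub_le_of_inner_nonpos (norm_sub_projK_le hq u) (h _ (projK_mem θ u))

theorem projK_eq_self (hu : u ∈ coneK θ) : projK θ u = u :=
  projK_eq_of_inner_nonpos hu fun z _ => by rw [sub_self, inner_zero_left]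

theorem sub_projK_of_snd_nonpos (hθ : 0 ≤ sin θ) (hu₀ : 0 ≤ u 0) (hu₁ : u 1 ≤ 0) :
    u - projK θ u = coordY₁ 0 u • unitVec 0 := by
  have hproj : projK θ u = !₂[0, u 1] := by
    refine projK_eq_of_inner_nonpos ⟨by simp, ?_⟩ fun z hz => ?_
    · simpa [coordY₁] using mul_nonpos_of_nonpos_of_nonneg hu₁ hθ
    · simpa [plane_inner_eq] using mul_nonpos_of_nonneg_of_nonpos hu₀ hz.1
  rw [hproj]
  ext i
  fin_cases i <;> simp [unitVec]

theorem sub_projK_of_mem_region₃ (hθ : 0 ≤ sin θ) (hu : u ∈ region₃ θ) :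
    u - projK θ u = coordY₁ θ u • unitVec θ := by
  have hproj : projK θ u = u - coordY₁ θ u • unitVec θ := by
    refine projK_eq_of_inner_nonpos ⟨?_, ?_⟩ fun z hz => ?_
    · have hfst : (u - coordY₁ θ u • unitVec θ) 0 = -(coordY₂ θ u * sin θ) := by
        simp only [coordY₁, coordY₂, unitVec, PiLp.sub_apply, PiLp.smul_apply,
          Matrix.cons_val_zero, smul_eq_mul]
        linear_combination -u 0 * sin_sq_add_cos_sq θ
      rw [hfst]
      exact neg_nonpos.2 (mul_nonneg hu.2 hθ)
    · simp [coordY₁_sub, coordY₁_smul]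
    · rw [sub_sub_cancel, real_inner_smul_left, inner_unitVec]
      simpa [coordY₁_sub, coordY₁_smul] using mul_nonpos_of_nonneg_of_nonpos hu.1 hz.2
  rw [hproj, sub_sub_cancel]

theorem projK_of_mem_region₂ (hθ : 0 < sin θ) (hu : u ∈ region₂ θ) : projK θ u = 0 := by
  refine projK_eq_of_inner_nonpos (zero_mem_coneK θ) fun z hz => ?_
  have hsplit : sin θ * inner ℝ u z = u 1 * coordY₁ θ z + -coordY₂ θ u * z 0 := by
    rw [plane_inner_eq, coordY₁, coordY₂]
    ring
  have hle : sin θ * inner ℝ u z ≤ 0 := by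
    rw [hsplit]
    exact add_nonpos (mul_nonpos_of_nonneg_of_nonpos hu.1 hz.2)
      (mul_nonpos_of_nonneg_of_nonpos (neg_nonneg.2 hu.2) hz.1)
  simpa only [sub_zero] using nonpos_of_mul_nonpos_right hle hθ

theorem penaltyForce_eq_dampedSpring (θ α k : ℝ) (u v : Plane) :
    penaltyForce θ α k u v = dampedSpring α k (u - projK θ u) (u - projK θ u) v := by
  have hdamp : dampG θ u v = radialPart (u - projK θ u) v := by
    unfold dampG
    split_ifs with hu
    · rw [projK_eq_self hu, sub_self, radialPart, smul_zero]
    · rfl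
  rw [penaltyForce, hdamp, dampedSpring]

theorem hasLinearGrowth_penaltyForce (hα : 0 ≤ α) (hk : 0 ≤ k) :
    HasLinearGrowth (penaltyForce θ α k) (2 * α * √k) k := fun u v => by
  rw [penaltyForce_eq_dampedSpring]
  refine (norm_dampedSpring_le hα hk _ _ _).trans ?_
  gcongr
  simpa only [sub_zero] using norm_sub_projK_le (zero_mem_coneK θ) u

theorem penaltyForce_eq_of_mem_region₂ (hθ : 0 < sin θ) (hu : u ∈ region₂ θ) (v : Plane) :
    penaltyForce θ α k u v = dampedSpring α k u u v := by
  rw [penaltyForce_eq_dampedSpring, projK_of_mem_region₂ hθ hu, sub_zero]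

/-- The force exerted by a straight side with outer normal `unitVec φ` on a body outside of it. -/
def sideForce (φ α k : ℝ) (u v : Plane) : Plane :=
  (2 * α * √k * coordY₁ φ v + k * coordY₁ φ u) • unitVec φ

theorem penaltyForce_eq_sideForce {φ : ℝ} (hu : coordY₁ φ u ≠ 0)
    (hproj : u - projK θ u = coordY₁ φ u • unitVec φ) (v : Plane) :
    penaltyForce θ α k u v = sideForce φ α k u v := by
  rw [penaltyForce_eq_dampedSpring, hproj, dampedSpring, radialPart_smul hu, radialPart,
    norm_unitVec, real_inner_comm, inner_unitVec, one_pow, div_one, smul_smul, smul_smul,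
    ← add_smul, sideForce]

theorem penaltyForce_eq_of_snd_nonpos (hθ : 0 ≤ sin θ) (hu₀ : 0 < u 0) (hu₁ : u 1 ≤ 0)
    (v : Plane) : penaltyForce θ α k u v = sideForce 0 α k u v :=
  penaltyForce_eq_sideForce (by simpa using hu₀.ne') (sub_projK_of_snd_nonpos hθ hu₀.le hu₁) v

theorem penaltyForce_eq_of_mem_region₃ (hθ : 0 ≤ sin θ) (hu : u ∈ region₃ θ)
    (hu₁ : coordY₁ θ u ≠ 0) (v : Plane) : penaltyForce θ α k u v = sideForce θ α k u v :=
  penaltyForce_eq_sideForce hu₁ (sub_projK_of_mem_region₃ hθ hu) v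

theorem exists_lipschitzWith_sideForce (φ α k : ℝ) :
    ∃ K, LipschitzWith K (Function.uncurry (sideForce φ α k)) := by
  let normal : Plane →L[ℝ] ℝ := innerSL ℝ (unitVec φ)
  let force : Plane × Plane →L[ℝ] Plane :=
    ((2 * α * √k) • normal.comp (.snd ℝ Plane Plane)
      + k • normal.comp (.fst ℝ Plane Plane)).smulRight (unitVec φ)
  have hforce : Function.uncurry (sideForce φ α k) = force := by
    ext1 z
    simp [force, normal, inner_unitVec, sideForce, Function.uncurry]
  exact ⟨_, hforce ▸ force.lipschitz⟩

end Projection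

section Oscillator

variable {α k p q t : ℝ}

/-- The smaller root of `ξ² + 2 α ξ + 1 = 0`. -/
def xi₂ (α : ℝ) : ℝ := -α - √(α ^ 2 - 1)

theorem sqrt_disc_pos (hα : 1 < α) : 0 < √(α ^ 2 - 1) :=
  sqrt_pos.2 (sub_pos.2 (one_lt_pow₀ hα two_ne_zero))

theorem xi₁_sub_xi₂ (α : ℝ) : xi₁ α - xi₂ α = 2 * √(α ^ 2 - 1) := by
  rw [xi₁, xi₂]
  ring

theorem xi₁_sub_xi₂_pos (hα : 1 < α) : 0 < xi₁ α - xi₂ α := by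
  rw [xi₁_sub_xi₂]
  exact mul_pos two_pos (sqrt_disc_pos hα)

theorem xi₁_neg (hα : 1 < α) : xi₁ α < 0 := by
  have hsqrt : √(α ^ 2 - 1) < α := (sqrt_lt' (one_pos.trans hα)).2 (sub_one_lt _)
  rw [xi₁]
  linarith

theorem xi₂_neg (hα : 1 < α) : xi₂ α < 0 := (sub_pos.1 (xi₁_sub_xi₂_pos hα)).trans (xi₁_neg hα)

theorem xi₁_sq (hα : 1 < α) : xi₁ α ^ 2 = -(2 * α * xi₁ α) - 1 := by
  have hsqrt : √(α ^ 2 - 1) ^ 2 = α ^ 2 - 1 := sq_sqrt (sqrt_pos.1 (sqrt_disc_pos hα)).le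
  rw [xi₁]
  linear_combination hsqrt

theorem xi₂_sq (hα : 1 < α) : xi₂ α ^ 2 = -(2 * α * xi₂ α) - 1 := by
  have hsqrt : √(α ^ 2 - 1) ^ 2 = α ^ 2 - 1 := sq_sqrt (sqrt_pos.1 (sqrt_disc_pos hα)).le
  rw [xi₂]
  linear_combination hsqrt

/-- The coefficient of the slow mode of the overdamped oscillator started at `p` with velocity
`q`. -/
def slowAmp (α k p q : ℝ) : ℝ := (q / √k - xi₂ α * p) / (xi₁ α - xi₂ α)

/-- The coefficient of the fast mode of the overdamped oscillator started at `p` with velocity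
`q`. -/
def fastAmp (α k p q : ℝ) : ℝ := (xi₁ α * p - q / √k) / (xi₁ α - xi₂ α)

/-- The position of the oscillator `x'' + 2 α √k x' + k x = 0` started at `p` with velocity `q`. -/
def oscPos (α k p q t : ℝ) : ℝ :=
  slowAmp α k p q * exp (xi₁ α * t * √k) + fastAmp α k p q * exp (xi₂ α * t * √k)

/-- The velocity of the oscillator `x'' + 2 α √k x' + k x = 0` started at `p` with velocity `q`. -/
def oscVel (α k p q t : ℝ) : ℝ :=
  √k * (xi₁ α * slowAmp α k p q * exp (xi₁ α * t * √k)
    + xi₂ α * fastAmp α k p q * exp (xi₂ α * t * √k))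

theorem hasDerivAt_exp_mul_mul (ξ c t : ℝ) :
    HasDerivAt (fun t => exp (ξ * t * c)) (exp (ξ * t * c) * (ξ * c)) t := by
  simpa using (((hasDerivAt_id t).const_mul ξ).mul_const c).exp

theorem hasDerivAt_oscPos (α k p q t : ℝ) :
    HasDerivAt (oscPos α k p q) (oscVel α k p q t) t := by
  refine (((hasDerivAt_exp_mul_mul (xi₁ α) √k t).const_mul (slowAmp α k p q)).add
    ((hasDerivAt_exp_mul_mul (xi₂ α) √k t).const_mul (fastAmp α k p q))).congr_deriv ?_
  rw [oscVel]
  ring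

theorem hasDerivAt_oscVel (hα : 1 < α) (hk : 0 ≤ k) (p q t : ℝ) :
    HasDerivAt (oscVel α k p q)
      (-(2 * α * √k * oscVel α k p q t + k * oscPos α k p q t)) t := by
  refine ((((hasDerivAt_exp_mul_mul (xi₁ α) √k t).const_mul (xi₁ α * slowAmp α k p q)).add
    ((hasDerivAt_exp_mul_mul (xi₂ α) √k t).const_mul
      (xi₂ α * fastAmp α k p q))).const_mul √k).congr_deriv ?_
  rw [oscVel, oscPos]
  linear_combination (√k ^ 2 * slowAmp α k p q * exp (xi₁ α * t * √k)) * xi₁_sq hα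
    + (√k ^ 2 * fastAmp α k p q * exp (xi₂ α * t * √k)) * xi₂_sq hα
    - (slowAmp α k p q * exp (xi₁ α * t * √k) + fastAmp α k p q * exp (xi₂ α * t * √k))
      * sq_sqrt hk

theorem slowAmp_add_fastAmp (hα : 1 < α) (k p q : ℝ) :
    slowAmp α k p q + fastAmp α k p q = p := by
  have hdisc := (xi₁_sub_xi₂_pos hα).ne'
  rw [slowAmp, fastAmp]
  field_simp
  ring

theorem oscPos_zero (hα : 1 < α) (k p q : ℝ) : oscPos α k p q 0 = p := by
  simp [oscPos, slowAmp_add_fastAmp hα]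

theorem oscVel_zero (hα : 1 < α) (hk : 0 < k) (p q : ℝ) : oscVel α k p q 0 = q := by
  have hdisc := (xi₁_sub_xi₂_pos hα).ne'
  have hsqrt := (sqrt_pos.2 hk).ne'
  simp only [oscVel, slowAmp, fastAmp, mul_zero, zero_mul, exp_zero, mul_one]
  field_simp
  ring

theorem slowAmp_pos (hα : 1 < α) (hk : 0 < k) (hp : 0 ≤ p) (hq : 0 < q) :
    0 < slowAmp α k p q := by
  have hq_div : 0 < q / √k := div_pos hq (sqrt_pos.2 hk)
  have hp_mul := mul_nonpos_of_nonpos_of_nonneg (xi₂_neg hα).le hp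
  exact div_pos (by linarith) (xi₁_sub_xi₂_pos hα)

theorem fastAmp_nonpos (hα : 1 < α) (hp : 0 ≤ p) (hq : 0 ≤ q) : fastAmp α k p q ≤ 0 := by
  have hq_div : 0 ≤ q / √k := by positivity
  have hp_mul := mul_nonpos_of_nonpos_of_nonneg (xi₁_neg hα).le hp
  exact div_nonpos_of_nonpos_of_nonneg (by linarith) (xi₁_sub_xi₂_pos hα).le

theorem oscPos_pos (hα : 1 < α) (hk : 0 < k) (hp : 0 ≤ p) (hq : 0 < q) (ht : 0 < t) :
    0 < oscPos α k p q t := by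
  have hmodes : exp (xi₂ α * t * √k) < exp (xi₁ α * t * √k) := by
    have := sub_pos.1 (xi₁_sub_xi₂_pos hα)
    gcongr
  calc 0 < slowAmp α k p q * (exp (xi₁ α * t * √k) - exp (xi₂ α * t * √k))
        + p * exp (xi₂ α * t * √k) :=
        add_pos_of_pos_of_nonneg (mul_pos (slowAmp_pos hα hk hp hq) (sub_pos.2 hmodes))
          (mul_nonneg hp (exp_pos _).le)
    _ = oscPos α k p q t := by
        rw [oscPos]
        linear_combination -exp (xi₂ α * t * √k) * slowAmp_add_fastAmp hα k p q

theorem oscPos_le (hα : 1 < α) (hp : 0 ≤ p) (hq : 0 ≤ q) (t : ℝ) :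
    oscPos α k p q t ≤ slowAmp α k p q * exp (xi₁ α * t * √k) :=
  add_le_of_nonpos_right
    (mul_nonpos_of_nonpos_of_nonneg (fastAmp_nonpos hα hp hq) (exp_pos _).le)

end Oscillator

section SideMotion

variable {θ α k t c : ℝ} {x y : Plane} {u v : ℝ → Plane}

/-- The position at time `t` of the motion under `sideForce φ α k` started at `x` with velocity
`y`: free tangentially to the side, an overdamped oscillation along its normal. -/
def sidePos (φ α k : ℝ) (x y : Plane) (t : ℝ) : Plane :=
  x + t • y + (oscPos α k (coordY₁ φ x) (coordY₁ φ y) t - coordY₁ φ x - t * coordY₁ φ y)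
    • unitVec φ

/-- The velocity at time `t` of the motion under `sideForce φ α k` started at `x` with velocity
`y`. -/
def sideVel (φ α k : ℝ) (x y : Plane) (t : ℝ) : Plane :=
  y + (oscVel α k (coordY₁ φ x) (coordY₁ φ y) t - coordY₁ φ y) • unitVec φ

theorem coordY₁_sidePos (φ α k : ℝ) (x y : Plane) (t : ℝ) :
    coordY₁ φ (sidePos φ α k x y t) = oscPos α k (coordY₁ φ x) (coordY₁ φ y) t := by
  simp [sidePos, coordY₁_add, coordY₁_smul]

theorem coordY₂_sidePos (φ α k : ℝ) (x y : Plane) (t : ℝ) :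
    coordY₂ φ (sidePos φ α k x y t) = coordY₂ φ x + t * coordY₂ φ y := by
  simp [sidePos, coordY₂_add, coordY₂_smul]

theorem coordY₁_sideVel (φ α k : ℝ) (x y : Plane) (t : ℝ) :
    coordY₁ φ (sideVel φ α k x y t) = oscVel α k (coordY₁ φ x) (coordY₁ φ y) t := by
  simp [sideVel, coordY₁_add, coordY₁_smul]

theorem coordY₂_sideVel (φ α k : ℝ) (x y : Plane) (t : ℝ) :
    coordY₂ φ (sideVel φ α k x y t) = coordY₂ φ y := by
  simp [sideVel, coordY₂_add, coordY₂_smul]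

theorem sidePos_zero (hα : 1 < α) (φ k : ℝ) (x y : Plane) : sidePos φ α k x y 0 = x := by
  simp [sidePos, oscPos_zero hα]

theorem sideVel_zero (hα : 1 < α) (hk : 0 < k) (φ : ℝ) (x y : Plane) :
    sideVel φ α k x y 0 = y := by
  simp [sideVel, oscVel_zero hα hk]

theorem hasDerivAt_sidePos (φ α k : ℝ) (x y : Plane) (t : ℝ) :
    HasDerivAt (sidePos φ α k x y) (sideVel φ α k x y t) t := by
  have hfree : HasDerivAt (fun t : ℝ => x + t • y) y t := by
    simpa using ((hasDerivAt_id t).smul_const y).const_add x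
  have hnormal : HasDerivAt
      (fun t => oscPos α k (coordY₁ φ x) (coordY₁ φ y) t - coordY₁ φ x - t * coordY₁ φ y)
      (oscVel α k (coordY₁ φ x) (coordY₁ φ y) t - coordY₁ φ y) t :=
    ((hasDerivAt_oscPos α k _ _ t).sub_const _).sub (hasDerivAt_mul_const _)
  exact hfree.add (hnormal.smul_const (unitVec φ))

theorem hasDerivAt_sideVel (hα : 1 < α) (hk : 0 ≤ k) (φ : ℝ) (x y : Plane) (t : ℝ) :
    HasDerivAt (sideVel φ α k x y)
      (-sideForce φ α k (sidePos φ α k x y t) (sideVel φ α k x y t)) t := by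
  rw [sideForce, coordY₁_sidePos, coordY₁_sideVel, ← neg_smul]
  exact (((hasDerivAt_oscVel hα hk _ _ t).sub_const _).smul_const (unitVec φ)).const_add y

theorem isMotionOn_sidePos (hα : 1 < α) (hk : 0 ≤ k) (φ : ℝ) (x y : Plane) (c : ℝ) :
    IsMotionOn (sideForce φ α k) univ (fun t => sidePos φ α k x y (t - c))
      (fun t => sideVel φ α k x y (t - c)) := by
  obtain ⟨K, hK⟩ := exists_lipschitzWith_sideForce φ α k
  exact .of_hasDerivWithinAt ordConnected_univ hK.continuous
    (fun t _ => ((hasDerivAt_sidePos φ α k x y (t - c)).comp_sub_const t c).hasDerivWithinAt)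
    (fun t _ => ((hasDerivAt_sideVel hα hk φ x y (t - c)).comp_sub_const t c).hasDerivWithinAt)

section FirstSide

variable {x₂₀ v₁₀ v₂₀ : ℝ}

theorem cornerTime_pos (hx : x₂₀ < 0) (hv₂ : 0 < v₂₀) : 0 < cornerTime x₂₀ v₂₀ :=
  div_pos (neg_pos.2 hx) hv₂

theorem sidePos_mem_before_corner (hα : 1 < α) (hk : 0 < k) (hv₁ : 0 < v₁₀) (hv₂ : 0 < v₂₀)
    (ht : t ∈ Ioo 0 (cornerTime x₂₀ v₂₀)) :
    0 < sidePos 0 α k !₂[0, x₂₀] !₂[v₁₀, v₂₀] t 0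
      ∧ sidePos 0 α k !₂[0, x₂₀] !₂[v₁₀, v₂₀] t 1 < 0 := by
  rw [← coordY₁_zero_left, ← coordY₂_zero_left, coordY₁_sidePos, coordY₂_sidePos]
  refine ⟨oscPos_pos hα hk (by simp) (by simpa using hv₁) ht.1, ?_⟩
  have hlt : t * v₂₀ < -x₂₀ := (lt_div_iff₀ hv₂).1 ht.2
  simpa using (show x₂₀ + t * v₂₀ < 0 by linarith)

theorem isMotionOn_penaltyForce_before_corner (hθ : 0 ≤ sin θ) (hα : 1 < α) (hk : 0 < k)
    (hv₁ : 0 < v₁₀) (hv₂ : 0 < v₂₀) :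
    IsMotionOn (penaltyForce θ α k) (Icc 0 (cornerTime x₂₀ v₂₀))
      (sidePos 0 α k !₂[0, x₂₀] !₂[v₁₀, v₂₀]) (sideVel 0 α k !₂[0, x₂₀] !₂[v₁₀, v₂₀]) := by
  have hside := isMotionOn_sidePos hα hk.le 0 !₂[0, x₂₀] !₂[v₁₀, v₂₀] 0
  simp only [sub_zero] at hside
  refine (hside.mono (subset_univ _)).congr_force ordConnected_Icc fun t ht => ?_
  rw [interior_Icc] at ht
  obtain ⟨hfst, hsnd⟩ := sidePos_mem_before_corner hα hk hv₁ hv₂ ht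
  exact (penaltyForce_eq_of_snd_nonpos hθ hfst hsnd.le _).symm

theorem IsMotionOn.eqOn_sidePos_before_corner (hθ : 0 ≤ sin θ) (hα : 1 < α) (hk : 0 < k)
    (hx : x₂₀ < 0) (hv₁ : 0 < v₁₀) (hv₂ : 0 < v₂₀)
    (h : IsMotionOn (penaltyForce θ α k) (Icc 0 (cornerTime x₂₀ v₂₀)) u v)
    (hu : u 0 = !₂[0, x₂₀]) (hv : v 0 = !₂[v₁₀, v₂₀]) :
    EqOn u (sidePos 0 α k !₂[0, x₂₀] !₂[v₁₀, v₂₀]) (Icc 0 (cornerTime x₂₀ v₂₀))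
      ∧ EqOn v (sideVel 0 α k !₂[0, x₂₀] !₂[v₁₀, v₂₀]) (Icc 0 (cornerTime x₂₀ v₂₀)) := by
  obtain ⟨K, hK⟩ := exists_lipschitzWith_sideForce 0 α k
  have ht₀ := cornerTime_pos hx hv₂
  have hderiv := h.hasDerivWithinAt_Ici 0 (left_mem_Ico.2 ht₀)
  have hside := isMotionOn_sidePos hα hk.le 0 !₂[0, x₂₀] !₂[v₁₀, v₂₀] 0
  simp only [sub_zero] at hside
  have hopen : IsOpen {z : Plane | 0 < coordY₁ 0 z ∧ coordY₂ 0 z < 0} :=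
    (isOpen_lt continuous_const (continuous_coordY₁ 0)).inter
      (isOpen_lt (continuous_coordY₂ 0) continuous_const)
  have hfst : ∀ᶠ t in 𝓝[>] 0, 0 < coordY₁ 0 (u t) :=
    eventually_pos_of_hasDerivWithinAt (hasDerivWithinAt_coordY₁ hderiv)
      (by simpa [hv] using hv₁) (by simp [hu])
  have hsnd : ∀ᶠ t in 𝓝[>] 0, coordY₂ 0 (u t) < 0 :=
    ((hasDerivWithinAt_coordY₂ hderiv).continuousWithinAt.mono Ioi_subset_Ici_self).eventually
      (gt_mem_nhds (by simpa [hu] using hx))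
  refine h.eqOn_of_eventually_mem hopen (fun z hz w => ?_) hK (hside.mono (subset_univ _))
    (by rw [hu, sidePos_zero hα]) (by rw [hv, sideVel_zero hα hk]) (hfst.and hsnd) fun t ht => ?_
  · exact penaltyForce_eq_of_snd_nonpos hθ (by simpa using hz.1) (by simpa using hz.2.le) w
  · simpa using sidePos_mem_before_corner hα hk hv₁ hv₂ ht

end FirstSide

section SecondSide

theorem sidePos_mem_interior_region₃ (hα : 1 < α) (hk : 0 < k) (hx₁ : 0 ≤ coordY₁ θ x)
    (hx₂ : 0 ≤ coordY₂ θ x) (hy₁ : 0 < coordY₁ θ y) (hy₂ : 0 < coordY₂ θ y) (ht : 0 < t) :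
    0 < coordY₁ θ (sidePos θ α k x y t) ∧ 0 < coordY₂ θ (sidePos θ α k x y t) := by
  rw [coordY₁_sidePos, coordY₂_sidePos]
  exact ⟨oscPos_pos hα hk hx₁ hy₁ ht, by positivity⟩

theorem isMotionOn_penaltyForce_after_crossing (hθ : 0 ≤ sin θ) (hα : 1 < α) (hk : 0 < k)
    (hx₁ : 0 ≤ coordY₁ θ x) (hx₂ : 0 ≤ coordY₂ θ x) (hy₁ : 0 < coordY₁ θ y)
    (hy₂ : 0 < coordY₂ θ y) (c : ℝ) :
    IsMotionOn (penaltyForce θ α k) (Ici c) (fun t => sidePos θ α k x y (t - c))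
      (fun t => sideVel θ α k x y (t - c)) := by
  refine ((isMotionOn_sidePos hα hk.le θ x y c).mono (subset_univ _)).congr_force
    ordConnected_Ici fun t ht => ?_
  rw [interior_Ici] at ht
  obtain ⟨hpos₁, hpos₂⟩ := sidePos_mem_interior_region₃ hα hk hx₁ hx₂ hy₁ hy₂ (sub_pos.2 ht)
  exact (penaltyForce_eq_of_mem_region₃ hθ ⟨hpos₁.le, hpos₂.le⟩ hpos₁.ne' _).symm

theorem IsMotionOn.eqOn_sidePos_after_crossing (hθ : 0 ≤ sin θ) (hα : 1 < α) (hk : 0 < k)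
    (h : IsMotionOn (penaltyForce θ α k) (Ici c) u v) (hu₁ : 0 < coordY₁ θ (u c))
    (hu₂ : coordY₂ θ (u c) = 0) (hv₁ : 0 < coordY₁ θ (v c)) (hv₂ : 0 < coordY₂ θ (v c)) :
    EqOn u (fun t => sidePos θ α k (u c) (v c) (t - c)) (Ici c) := by
  obtain ⟨K, hK⟩ := exists_lipschitzWith_sideForce θ α k
  have hderiv := h.hasDerivWithinAt c self_mem_Ici
  have hopen : IsOpen {z : Plane | 0 < coordY₁ θ z ∧ 0 < coordY₂ θ z} :=
    (isOpen_lt continuous_const (continuous_coordY₁ θ)).inter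
      (isOpen_lt continuous_const (continuous_coordY₂ θ))
  have hpos₁ : ∀ᶠ t in 𝓝[>] c, 0 < coordY₁ θ (u t) :=
    ((hasDerivWithinAt_coordY₁ hderiv).continuousWithinAt.mono Ioi_subset_Ici_self).eventually
      (lt_mem_nhds hu₁)
  have hpos₂ : ∀ᶠ t in 𝓝[>] c, 0 < coordY₂ θ (u t) :=
    eventually_pos_of_hasDerivWithinAt (hasDerivWithinAt_coordY₂ hderiv) hv₂ hu₂
  intro t ht
  refine ((h.mono Icc_subset_Ici_self).eqOn_of_eventually_mem (d := t) hopen (fun z hz w => ?_) hK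
    ((isMotionOn_sidePos hα hk.le θ (u c) (v c) c).mono (subset_univ _)) ?_ ?_
    (hpos₁.and hpos₂) fun s hs => ?_).1 ⟨ht, le_rfl⟩
  · exact penaltyForce_eq_of_mem_region₃ hθ ⟨hz.1.le, hz.2.le⟩ hz.1.ne' w
  · rw [sub_self, sidePos_zero hα]
  · rw [sub_self, sideVel_zero hα hk]
  · exact sidePos_mem_interior_region₃ hα hk hu₁.le hu₂.ge hv₁ hv₂ (sub_pos.2 hs.1)

end SecondSide

end SideMotion

section NearlyFree

variable {θ φ v₂₀ ρ X a b s t T : ℝ} {u v : ℝ → Plane}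

/-- A motion on the times `Icc a b` that starts at `(X, 0)` and whose velocity stays within `ρ` of
`(0, v₂₀)`. Near the vertex, the penalized motion is of this kind. -/
structure IsNearlyFree (v₂₀ ρ X a b : ℝ) (u v : ℝ → Plane) : Prop where
  hasDerivWithinAt : ∀ t ∈ Icc a b, HasDerivWithinAt u (v t) (Icc a b) t
  norm_vel_sub_le : ∀ t ∈ Icc a b, ‖v t - !₂[0, v₂₀]‖ ≤ ρ
  start : u a = !₂[X, 0]

/-- Twice the time in which the free motion with velocity `(0, v₂₀)` crosses `region₂ θ` starting
from `(X, 0)`. -/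
def transitTime (θ v₂₀ X : ℝ) : ℝ := 2 * (X * tan θ) / v₂₀

theorem transitTime_pos (hsin : 0 < sin θ) (hcos : 0 < cos θ) (hv₂ : 0 < v₂₀) (hX : 0 < X) :
    0 < transitTime θ v₂₀ X := by
  rw [transitTime, tan_eq_sin_div_cos]
  positivity

theorem transitTime_mul (hcos : cos θ ≠ 0) (hv₂ : v₂₀ ≠ 0) (X : ℝ) :
    transitTime θ v₂₀ X * (v₂₀ * cos θ) = 2 * (X * sin θ) := by
  rw [transitTime, tan_eq_sin_div_cos]
  field_simp

/-- A nearly free motion from `(X, 0)` at the time `a` meets the line `coordY₂ θ = 0`, where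
`region₂ θ` ends, at the time `T`. -/
structure CrossesVertexRegion (θ v₂₀ ρ X a T : ℝ) (u v : ℝ → Plane) : Prop where
  isNearlyFree : IsNearlyFree v₂₀ ρ X a (a + transitTime θ v₂₀ X) u v
  mem_Ioo : T ∈ Ioo a (a + transitTime θ v₂₀ X)
  coordY₂_eq_zero : coordY₂ θ (u T) = 0

theorem norm_pair_le (x y : ℝ) : ‖(!₂[x, y] : Plane)‖ ≤ |x| + |y| := by
  refine (sq_le_sq₀ (norm_nonneg _) (by positivity)).1 ?_
  rw [plane_norm_sq_eq]
  simp only [Matrix.cons_val_zero, Matrix.cons_val_one]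
  nlinarith [sq_abs x, sq_abs y, abs_nonneg x, abs_nonneg y]

theorem coordY₁_zero_snd (φ y : ℝ) : coordY₁ φ !₂[0, y] = y * sin φ := by
  simp [coordY₁]

namespace IsNearlyFree

theorem abs_coordY₁_sub_le (h : IsNearlyFree v₂₀ ρ X a b u v) (φ : ℝ) (hs : a ≤ s) (hst : s ≤ t)
    (ht : t ≤ b) :
    |coordY₁ φ (u t) - coordY₁ φ (u s) - (t - s) * (v₂₀ * sin φ)| ≤ ρ * (t - s) := by
  have hsub : Icc s t ⊆ Icc a b := Icc_subset_Icc hs ht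
  have hline := norm_sub_sub_smul_le (fun r hr => (h.hasDerivWithinAt r (hsub hr)).mono hsub)
    (fun r hr => h.norm_vel_sub_le r (hsub hr)) (right_mem_Icc.2 hst)
  simpa only [coordY₁_sub, coordY₁_smul, coordY₁_zero_snd] using (abs_coordY₁_le φ _).trans hline

theorem abs_coordY₂_sub_le (h : IsNearlyFree v₂₀ ρ X a b u v) (φ : ℝ) (hs : a ≤ s) (hst : s ≤ t)
    (ht : t ≤ b) :
    |coordY₂ φ (u t) - coordY₂ φ (u s) - (t - s) * (v₂₀ * cos φ)| ≤ ρ * (t - s) := by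
  simpa only [coordY₁_add_pi_div_two, sin_add_pi_div_two] using
    h.abs_coordY₁_sub_le (φ + π / 2) hs hst ht

theorem abs_coordY₁_vel_sub_le (h : IsNearlyFree v₂₀ ρ X a b u v) (φ : ℝ) (ht : t ∈ Icc a b) :
    |coordY₁ φ (v t) - v₂₀ * sin φ| ≤ ρ := by
  simpa only [coordY₁_sub, coordY₁_zero_snd] using
    (abs_coordY₁_le φ (v t - !₂[0, v₂₀])).trans (h.norm_vel_sub_le t ht)

theorem abs_coordY₂_vel_sub_le (h : IsNearlyFree v₂₀ ρ X a b u v) (φ : ℝ) (ht : t ∈ Icc a b) :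
    |coordY₂ φ (v t) - v₂₀ * cos φ| ≤ ρ := by
  simpa only [coordY₁_add_pi_div_two, sin_add_pi_div_two] using
    h.abs_coordY₁_vel_sub_le (φ + π / 2) ht

theorem strictMonoOn_coordY₂ (h : IsNearlyFree v₂₀ ρ X a b u v) (hρ : ρ < v₂₀ * cos φ) :
    StrictMonoOn (fun t => coordY₂ φ (u t)) (Icc a b) := fun s hs t ht hst => by
  have hlower := (abs_le.1 (h.abs_coordY₂_sub_le φ hs.1 hst.le ht.2)).1
  have hrate := mul_lt_mul_of_pos_right hρ (sub_pos.2 hst)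
  beta_reduce
  linarith

theorem coordY₁_start (h : IsNearlyFree v₂₀ ρ X a b u v) (φ : ℝ) :
    coordY₁ φ (u a) = X * cos φ := by
  simp [h.start, coordY₁]

theorem coordY₂_start (h : IsNearlyFree v₂₀ ρ X a b u v) (φ : ℝ) :
    coordY₂ φ (u a) = -(X * sin φ) := by
  simp [h.start, coordY₂]

theorem norm_le (h : IsNearlyFree v₂₀ ρ X a b u v) (hX : 0 ≤ X) (hv₂ : 0 ≤ v₂₀)
    (ht : t ∈ Icc a b) : ‖u t‖ ≤ X + (ρ + v₂₀) * (t - a) := by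
  have hspeed : ∀ r ∈ Icc a b, ‖v r‖ ≤ ρ + v₂₀ := fun r hr =>
    calc ‖v r‖ = ‖(v r - !₂[0, v₂₀]) + !₂[0, v₂₀]‖ := by rw [sub_add_cancel]
      _ ≤ ρ + ‖(!₂[0, v₂₀] : Plane)‖ :=
        (norm_add_le _ _).trans (add_le_add_left (h.norm_vel_sub_le r hr) _)
      _ ≤ ρ + v₂₀ := by
        gcongr
        simpa [abs_of_nonneg hv₂] using norm_pair_le 0 v₂₀
  have hmove := norm_image_sub_le_of_norm_deriv_le_segment' h.hasDerivWithinAt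
    (fun r hr => hspeed r (Ico_subset_Icc_self hr)) t ht
  calc ‖u t‖ ≤ ‖u a‖ + ‖u t - u a‖ := norm_le_norm_add_norm_sub' _ _
    _ ≤ X + (ρ + v₂₀) * (t - a) := by
      gcongr
      simpa [h.start, abs_of_nonneg hX] using norm_pair_le X 0

theorem exists_crossesVertexRegion (h : IsNearlyFree v₂₀ ρ X a (a + transitTime θ v₂₀ X) u v)
    (hsin : 0 < sin θ) (hcos : 0 < cos θ) (hv₂ : 0 < v₂₀) (hX : 0 < X)
    (hρ : ρ ≤ v₂₀ * cos θ / 4) :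
    ∃ T, CrossesVertexRegion θ v₂₀ ρ X a T u v := by
  have htransit := transitTime_pos hsin hcos hv₂ hX
  have hend : 0 < coordY₂ θ (u (a + transitTime θ v₂₀ X)) := by
    have hlower := (abs_le.1 (h.abs_coordY₂_sub_le θ le_rfl (le_add_of_nonneg_right htransit.le)
      le_rfl)).1
    have hdev := mul_le_mul_of_nonneg_right hρ htransit.le
    rw [h.coordY₂_start, add_sub_cancel_left] at hlower
    linarith [transitTime_mul hcos.ne' hv₂.ne' X, mul_pos hX hsin]
  have hcont : ContinuousOn (fun t => coordY₂ θ (u t)) (Icc a (a + transitTime θ v₂₀ X)) :=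
    (continuous_coordY₂ θ).comp_continuousOn fun t ht =>
      (h.hasDerivWithinAt t ht).continuousWithinAt
  have hstart : coordY₂ θ (u a) < 0 := by
    rw [h.coordY₂_start]
    exact neg_lt_zero.2 (mul_pos hX hsin)
  obtain ⟨T, hT, hzero⟩ :=
    intermediate_value_Ioo (le_add_of_nonneg_right htransit.le) hcont ⟨hstart, hend⟩
  exact ⟨T, h, hT, hzero⟩

theorem half_le_fst (h : IsNearlyFree v₂₀ ρ X a (a + transitTime θ v₂₀ X) u v)
    (hcos : 0 < cos θ) (hv₂ : 0 < v₂₀) (hX : 0 < X) (hρ : ρ ≤ v₂₀ * cos θ / 4)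
    (ht : t ∈ Icc a (a + transitTime θ v₂₀ X)) : X / 2 ≤ u t 0 := by
  have hlower := (abs_le.1 (h.abs_coordY₁_sub_le 0 le_rfl ht.1 ht.2)).1
  rw [h.coordY₁_start, coordY₁_zero_left, sin_zero, cos_zero, mul_zero, mul_zero] at hlower
  have hdev : ρ * (t - a) ≤ X / 2 :=
    calc ρ * (t - a) ≤ v₂₀ * cos θ / 4 * transitTime θ v₂₀ X :=
          mul_le_mul hρ (sub_le_iff_le_add'.2 ht.2) (sub_nonneg.2 ht.1) (by positivity)
      _ = X * sin θ / 2 := by linear_combination transitTime_mul hcos.ne' hv₂.ne' X / 4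
      _ ≤ X / 2 := by
        gcongr
        exact mul_le_of_le_one_right hX.le (sin_le_one θ)
  linarith

end IsNearlyFree

namespace CrossesVertexRegion

theorem mem_Icc (h : CrossesVertexRegion θ v₂₀ ρ X a T u v) :
    T ∈ Icc a (a + transitTime θ v₂₀ X) :=
  Ioo_subset_Icc_self h.mem_Ioo

theorem mem_region₂ (h : CrossesVertexRegion θ v₂₀ ρ X a T u v) (hv₂ : 0 < v₂₀)
    (hρ : ρ < v₂₀ * cos θ) (ht : t ∈ Icc a T) : u t ∈ region₂ θ := by
  have hρ_snd : ρ < v₂₀ * cos 0 := by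
    rw [cos_zero, mul_one]
    exact hρ.trans_le (mul_le_of_le_one_right hv₂.le (cos_le_one θ))
  have ht_mem := Icc_subset_Icc_right h.mem_Icc.2 ht
  have hsnd := (h.isNearlyFree.strictMonoOn_coordY₂ hρ_snd).monotoneOn
    (left_mem_Icc.2 (ht_mem.1.trans ht_mem.2)) ht_mem ht.1
  exact ⟨by simpa [h.isNearlyFree.start] using hsnd, h.coordY₂_eq_zero ▸
    (h.isNearlyFree.strictMonoOn_coordY₂ hρ).monotoneOn ht_mem h.mem_Icc ht.2⟩

theorem coordY₂_neg (h : CrossesVertexRegion θ v₂₀ ρ X a T u v) (hρ : ρ < v₂₀ * cos θ)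
    (ht : t ∈ Ico a T) : coordY₂ θ (u t) < 0 :=
  h.coordY₂_eq_zero ▸ h.isNearlyFree.strictMonoOn_coordY₂ hρ
    (Icc_subset_Icc_right h.mem_Icc.2 (Ico_subset_Icc_self ht)) h.mem_Icc ht.2

theorem coordY₁_pos (h : CrossesVertexRegion θ v₂₀ ρ X a T u v) (hsin : 0 < sin θ)
    (hcos : 0 < cos θ) (hv₂ : 0 < v₂₀) (hX : 0 < X) (hρ : ρ ≤ v₂₀ * cos θ / 4) :
    0 < coordY₁ θ (u T) := by
  have hrate := mul_pos hv₂ hcos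
  have hfst : 0 < u T 0 :=
    (half_pos hX).trans_le (h.isNearlyFree.half_le_fst hcos hv₂ hX hρ h.mem_Icc)
  have hsnd := (h.mem_region₂ hv₂ (by linarith) (right_mem_Icc.2 h.mem_Ioo.1.le)).1
  unfold coordY₁
  positivity

theorem coordY₁_vel_pos (h : CrossesVertexRegion θ v₂₀ ρ X a T u v) (hρ : ρ < v₂₀ * sin θ) :
    0 < coordY₁ θ (v T) := by
  linarith [(abs_le.1 (h.isNearlyFree.abs_coordY₁_vel_sub_le θ h.mem_Icc)).1]

theorem coordY₂_vel_pos (h : CrossesVertexRegion θ v₂₀ ρ X a T u v) (hρ : ρ < v₂₀ * cos θ) :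
    0 < coordY₂ θ (v T) := by
  linarith [(abs_le.1 (h.isNearlyFree.abs_coordY₂_vel_sub_le θ h.mem_Icc)).1]

theorem abs_pos_sub_duration_le (h : CrossesVertexRegion θ v₂₀ ρ X a T u v) :
    |X * sin θ - (T - a) * (v₂₀ * cos θ)| ≤ ρ * (T - a) := by
  simpa only [h.coordY₂_eq_zero, h.isNearlyFree.coordY₂_start, zero_sub, neg_neg] using
    h.isNearlyFree.abs_coordY₂_sub_le θ le_rfl h.mem_Icc.1 h.mem_Icc.2

end CrossesVertexRegion

end NearlyFree

section VertexCrossing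

variable {θ α k v₂₀ X D a : ℝ} {F : Plane → Plane → Plane} {u v : ℝ → Plane}

theorem exists_lipschitzOnWith_comp_of_contDiffAt {M E G : Type*} [PseudoMetricSpace M]
    [NormedAddCommGroup E] [NormedSpace ℝ E] [NormedAddCommGroup G] [NormedSpace ℝ G] {s : Set M}
    (hs : IsCompact s) {p : M → E} {C : NNReal} (hp : LipschitzWith C p) {f : E → G}
    (hf : ∀ z ∈ s, ContDiffAt ℝ 1 f (p z)) : ∃ K, LipschitzOnWith K (f ∘ p) s := by
  have hloc : LocallyLipschitzOn (p '' s) f := by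
    rintro _ ⟨z, hz, rfl⟩
    obtain ⟨K, t, ht, hK⟩ := (hf z hz).exists_lipschitzOnWith
    exact ⟨K, t, mem_nhdsWithin_of_mem_nhds ht, hK⟩
  obtain ⟨K, hK⟩ := hloc.exists_lipschitzOnWith_of_compact (hs.image hp.continuous)
  exact ⟨_, hK.comp hp.lipschitzOnWith (mapsTo_image _ _)⟩

/-- The point `x` moved to the half plane where the first coordinate is at least `δ`. For `δ > 0`
this removes the singularity of `radialPart` at the vertex. -/
def clipFst (δ : ℝ) (x : Plane) : Plane := !₂[max (x 0) δ, x 1]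

theorem clipFst_eq_self {δ : ℝ} {x : Plane} (hx : δ ≤ x 0) : clipFst δ x = x := by
  ext i
  fin_cases i <;> simp [clipFst, hx]

theorem clipFst_ne_zero {δ : ℝ} (hδ : 0 < δ) (x : Plane) : clipFst δ x ≠ 0 := fun hzero =>
  (lt_max_of_lt_right hδ).ne' (congrArg (fun y : Plane => y 0) hzero)

theorem lipschitzWith_clipFst (δ : ℝ) : LipschitzWith 1 (clipFst δ) := by
  refine LipschitzWith.of_dist_le_mul fun x y => ?_
  rw [NNReal.coe_one, one_mul, dist_eq_norm, dist_eq_norm,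
    ← sq_le_sq₀ (norm_nonneg _) (norm_nonneg _), plane_norm_sq_eq, plane_norm_sq_eq]
  exact add_le_add_left (sq_le_sq.2 (abs_max_sub_max_le_abs (x 0) (y 0) δ)) _

/-- The force of the penalized equation over the vertex, with the direction of the damping clipped
so that it is locally Lipschitz. -/
def clippedForce (α k δ : ℝ) (u v : Plane) : Plane := dampedSpring α k (clipFst δ u) u v

theorem hasLinearGrowth_clippedForce (hα : 0 ≤ α) (hk : 0 ≤ k) (δ : ℝ) :
    HasLinearGrowth (clippedForce α k δ) (2 * α * √k) k := fun u v =>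
  norm_dampedSpring_le hα hk (clipFst δ u) u v

theorem lipschitzWith_clipFst_prod (δ : ℝ) :
    LipschitzWith (max (1 * 1) 1) (fun z : Plane × Plane => (clipFst δ z.1, z.2)) :=
  ((lipschitzWith_clipFst δ).comp LipschitzWith.prod_fst).prodMk LipschitzWith.prod_snd

theorem contDiffAt_radialPart_clipFst {δ : ℝ} (hδ : 0 < δ) (z : Plane × Plane) :
    ContDiffAt ℝ 1 (fun z : Plane × Plane => radialPart z.1 z.2) (clipFst δ z.1, z.2) :=
  contDiffAt_radialPart (z := (clipFst δ z.1, z.2)) (clipFst_ne_zero hδ z.1)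

theorem continuous_clippedForce {δ : ℝ} (hδ : 0 < δ) (α k : ℝ) :
    Continuous (Function.uncurry (clippedForce α k δ)) := by
  have hradial : Continuous fun z : Plane × Plane => radialPart (clipFst δ z.1) z.2 :=
    continuous_iff_continuousAt.2 fun z =>
      (contDiffAt_radialPart_clipFst hδ z).continuousAt.comp
        (f := fun z : Plane × Plane => (clipFst δ z.1, z.2))
        (lipschitzWith_clipFst_prod δ).continuous.continuousAt
  exact (hradial.const_smul (2 * α * √k)).add (continuous_fst.const_smul k)

theorem exists_lipschitzOnWith_clippedForce {δ : ℝ} (hδ : 0 < δ) (α k : ℝ) (z : Plane × Plane)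
    (r : ℝ) : ∃ K, LipschitzOnWith K (Function.uncurry (clippedForce α k δ))
      (Metric.closedBall z r) := by
  obtain ⟨K, hK⟩ := exists_lipschitzOnWith_comp_of_contDiffAt (isCompact_closedBall z r)
    (lipschitzWith_clipFst_prod δ) fun w _ => contDiffAt_radialPart_clipFst hδ w
  exact ⟨_, ((lipschitzWith_smul (β := Plane) (2 * α * √k)).comp_lipschitzOnWith hK).add
    ((lipschitzWith_smul (β := Plane) k).comp LipschitzWith.prod_fst).lipschitzOnWith⟩

/-- A bound on the deviation from `(0, v₂₀)` of the velocity of a motion that starts over the vertex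
at `(X, 0)` with velocity `(D, v₂₀)`. -/
def crossingDrift (θ α k v₂₀ X D : ℝ) : ℝ :=
  driftBound (2 * α * √k) k (transitTime θ v₂₀ X) X (|D| + v₂₀) + |D|

/-- The smallness conditions under which a motion starting at `(X, 0)` with velocity `(D, v₂₀)`
exists for the time `transitTime θ v₂₀ X` and is so nearly free that it crosses `region₂ θ`. -/
structure IsQuickCrossing (θ α k v₂₀ X D : ℝ) : Prop where
  time_le : transitTime θ v₂₀ X * (2 * α * √k + k * transitTime θ v₂₀ X) ≤ 1 / 2
  drift_le_cos : crossingDrift θ α k v₂₀ X D ≤ v₂₀ * cos θ / 4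
  drift_le_sin : crossingDrift θ α k v₂₀ X D ≤ v₂₀ * sin θ / 4
  sqrt_mul_pos_le : √k * X ≤ 1
  existence_time_le : (|D| + v₂₀ + 1 + (2 * α * √k * (|D| + v₂₀ + 1) + k * (X + 1))) *
    transitTime θ v₂₀ X ≤ 1

theorem IsQuickCrossing.drift_lt_cos (hq : IsQuickCrossing θ α k v₂₀ X D) (hcos : 0 < cos θ)
    (hv₂ : 0 < v₂₀) : crossingDrift θ α k v₂₀ X D < v₂₀ * cos θ := by
  linarith [hq.drift_le_cos, mul_pos hv₂ hcos]

theorem IsQuickCrossing.drift_lt_sin (hq : IsQuickCrossing θ α k v₂₀ X D) (hsin : 0 < sin θ)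
    (hv₂ : 0 < v₂₀) : crossingDrift θ α k v₂₀ X D < v₂₀ * sin θ := by
  linarith [hq.drift_le_sin, mul_pos hv₂ hsin]

theorem IsQuickCrossing.isNearlyFree (hq : IsQuickCrossing θ α k v₂₀ X D)
    (hF : HasLinearGrowth F (2 * α * √k) k) (hα : 0 ≤ α) (hk : 0 ≤ k) (hX : 0 ≤ X) (hv₂ : 0 ≤ v₂₀)
    (h : IsMotionOn F (Icc a (a + transitTime θ v₂₀ X)) u v) (hu : u a = !₂[X, 0])
    (hv : v a = !₂[D, v₂₀]) :
    IsNearlyFree v₂₀ (crossingDrift θ α k v₂₀ X D) X a (a + transitTime θ v₂₀ X) u v where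
  hasDerivWithinAt := h.hasDerivWithinAt
  start := hu
  norm_vel_sub_le t ht := by
    have htime : 0 ≤ transitTime θ v₂₀ X := le_add_iff_nonneg_right a |>.1 (ht.1.trans ht.2)
    have hdrift := h.norm_vel_sub_le hF (by positivity) hk
      (by simpa only [add_sub_cancel_left] using hq.time_le) ht
    have hpos : ‖u a‖ ≤ X := by simpa [hu, abs_of_nonneg hX] using norm_pair_le X 0
    have hspeed : ‖v a‖ ≤ |D| + v₂₀ := by
      simpa [hv, abs_of_nonneg hv₂] using norm_pair_le D v₂₀
    have hstart : ‖v a - !₂[0, v₂₀]‖ ≤ |D| := by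
      have hdiff : v a - !₂[0, v₂₀] = !₂[D, 0] := by
        ext i
        fin_cases i <;> simp [hv]
      simpa [hdiff] using norm_pair_le D 0
    rw [add_sub_cancel_left] at hdrift
    exact (norm_sub_le_norm_sub_add_norm_sub _ (v a) _).trans (add_le_add
      (hdrift.trans (driftBound_mono (by positivity) hk htime hpos hspeed)) hstart)

theorem IsQuickCrossing.exists_isMotionOn_clippedForce (hq : IsQuickCrossing θ α k v₂₀ X D)
    (hα : 0 ≤ α) (hk : 0 ≤ k) (hX : 0 < X) (hv₂ : 0 ≤ v₂₀) (htime : 0 ≤ transitTime θ v₂₀ X)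
    {δ : ℝ} (hδ : 0 < δ) (a : ℝ) :
    ∃ u v : ℝ → Plane, u a = !₂[X, 0] ∧ v a = !₂[D, v₂₀] ∧
      IsMotionOn (clippedForce α k δ) (Icc a (a + transitTime θ v₂₀ X)) u v := by
  obtain ⟨K, hK⟩ := exists_lipschitzOnWith_clippedForce hδ α k (!₂[X, 0], !₂[D, v₂₀]) 1
  refine exists_isMotionOn_of_lipschitzOnWith (hasLinearGrowth_clippedForce hα hk δ)
    (continuous_clippedForce hδ α k) (by positivity) hk htime hK ?_ a
  have hpos : ‖(!₂[X, 0] : Plane)‖ ≤ X := by simpa [abs_of_pos hX] using norm_pair_le X 0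
  have hspeed : ‖(!₂[D, v₂₀] : Plane)‖ ≤ |D| + v₂₀ := by
    simpa [abs_of_nonneg hv₂] using norm_pair_le D v₂₀
  exact hq.existence_time_le.trans' (by gcongr)

theorem IsQuickCrossing.exists_isMotionOn_penaltyForce_vertex
    (hq : IsQuickCrossing θ α k v₂₀ X D) (hsin : 0 < sin θ) (hcos : 0 < cos θ) (hα : 0 ≤ α)
    (hk : 0 ≤ k) (hX : 0 < X) (hv₂ : 0 < v₂₀) (a : ℝ) :
    ∃ T, ∃ u v : ℝ → Plane, v a = !₂[D, v₂₀] ∧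
      CrossesVertexRegion θ v₂₀ (crossingDrift θ α k v₂₀ X D) X a T u v ∧
      IsMotionOn (penaltyForce θ α k) (Icc a T) u v := by
  obtain ⟨u, v, hu, hv, h⟩ := hq.exists_isMotionOn_clippedForce hα hk hX hv₂.le
    (transitTime_pos hsin hcos hv₂ hX).le (half_pos hX) a
  have hfree := hq.isNearlyFree (hasLinearGrowth_clippedForce hα hk _) hα hk hX.le hv₂.le h hu hv
  obtain ⟨T, hT⟩ := hfree.exists_crossesVertexRegion hsin hcos hv₂ hX hq.drift_le_cos
  have hsub : Icc a T ⊆ Icc a (a + transitTime θ v₂₀ X) := Icc_subset_Icc_right hT.mem_Icc.2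
  refine ⟨T, u, v, hv, hT, (h.mono hsub).congr_force ordConnected_Icc fun t ht => ?_⟩
  have ht_mem := interior_subset ht
  rw [penaltyForce_eq_of_mem_region₂ hsin
      (hT.mem_region₂ hv₂ (hq.drift_lt_cos hcos hv₂) ht_mem),
    clippedForce, clipFst_eq_self (hfree.half_le_fst hcos hv₂ hX hq.drift_le_cos (hsub ht_mem))]

theorem IsQuickCrossing.exists_isMotionOn_penaltyForce_Ici
    (hq : IsQuickCrossing θ α k v₂₀ X D) (hsin : 0 < sin θ) (hcos : 0 < cos θ) (hα : 1 < α)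
    (hk : 0 < k) (hX : 0 < X) (hv₂ : 0 < v₂₀) (a : ℝ) :
    ∃ u v : ℝ → Plane, u a = !₂[X, 0] ∧ v a = !₂[D, v₂₀] ∧
      IsMotionOn (penaltyForce θ α k) (Ici a) u v := by
  obtain ⟨T, u, v, hv, hT, h⟩ := hq.exists_isMotionOn_penaltyForce_vertex hsin hcos
    (zero_le_one.trans hα.le) hk.le hX hv₂ a
  have hafter := isMotionOn_penaltyForce_after_crossing hsin.le hα hk
    (hT.coordY₁_pos hsin hcos hv₂ hX hq.drift_le_cos).le hT.coordY₂_eq_zero.ge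
    (hT.coordY₁_vel_pos (hq.drift_lt_sin hsin hv₂))
    (hT.coordY₂_vel_pos (hq.drift_lt_cos hcos hv₂)) T
  obtain ⟨u', v', hu', hv', h'⟩ := h.exists_concat hT.mem_Ioo.1.le hafter
    (by simp [sidePos_zero hα]) (by simp [sideVel_zero hα hk])
  exact ⟨u', v', hu'.trans hT.isNearlyFree.start, hv'.trans hv, h'⟩

theorem IsQuickCrossing.exists_crossesVertexRegion_of_isMotionOn
    (hq : IsQuickCrossing θ α k v₂₀ X D) (hsin : 0 < sin θ) (hcos : 0 < cos θ) (hα : 1 < α)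
    (hk : 0 < k) (hX : 0 < X) (hv₂ : 0 < v₂₀) (h : IsMotionOn (penaltyForce θ α k) (Ici a) u v)
    (hu : u a = !₂[X, 0]) (hv : v a = !₂[D, v₂₀]) :
    ∃ T, CrossesVertexRegion θ v₂₀ (crossingDrift θ α k v₂₀ X D) X a T u v ∧
      EqOn u (fun t => sidePos θ α k (u T) (v T) (t - T)) (Ici T) := by
  have hα_nonneg : 0 ≤ α := zero_le_one.trans hα.le
  have hfree := hq.isNearlyFree (hasLinearGrowth_penaltyForce hα_nonneg hk.le) hα_nonneg hk.le
    hX.le hv₂.le (h.mono Icc_subset_Ici_self) hu hv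
  obtain ⟨T, hT⟩ := hfree.exists_crossesVertexRegion hsin hcos hv₂ hX hq.drift_le_cos
  exact ⟨T, hT, (h.mono (Ici_subset_Ici.2 hT.mem_Ioo.1.le)).eqOn_sidePos_after_crossing hsin.le hα
    hk (hT.coordY₁_pos hsin hcos hv₂ hX hq.drift_le_cos) hT.coordY₂_eq_zero
    (hT.coordY₁_vel_pos (hq.drift_lt_sin hsin hv₂))
    (hT.coordY₂_vel_pos (hq.drift_lt_cos hcos hv₂))⟩

end VertexCrossing

section CornerPassage

variable {θ α k v₂₀ p q X D ρ a t T : ℝ} {u v : ℝ → Plane}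

/-- The motion has passed the corner: it stays over the first side of the cone until the time `a`,
over the vertex until the time `T`, and follows the motion over the second side afterwards. -/
structure PassesCorner (θ α k v₂₀ ρ X a T : ℝ) (u v : ℝ → Plane) : Prop
    extends CrossesVertexRegion θ v₂₀ ρ X a T u v where
  before : ∀ t ∈ Ico 0 a, 0 ≤ u t 0 ∧ u t 1 < 0
  after : EqOn u (fun t => sidePos θ α k (u T) (v T) (t - T)) (Ici T)

namespace PassesCorner

theorem coordY₁_eq (h : PassesCorner θ α k v₂₀ ρ X a T u v) (ht : T ≤ t) :
    coordY₁ θ (u t) = oscPos α k (coordY₁ θ (u T)) (coordY₁ θ (v T)) (t - T) := by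
  rw [h.after ht, coordY₁_sidePos]

theorem coordY₂_eq (h : PassesCorner θ α k v₂₀ ρ X a T u v) (ht : T ≤ t) :
    coordY₂ θ (u t) = (t - T) * coordY₂ θ (v T) := by
  rw [h.after ht, coordY₂_sidePos, h.coordY₂_eq_zero, zero_add]

theorem coordY₁_nonneg (h : PassesCorner θ α k v₂₀ ρ X a T u v) (hα : 1 < α) (hk : 0 < k)
    (hpos : 0 < coordY₁ θ (u T)) (hρ : ρ < v₂₀ * sin θ) (ht : T ≤ t) : 0 ≤ coordY₁ θ (u t) := by
  rcases ht.eq_or_lt with rfl | hlt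
  · exact hpos.le
  · rw [h.coordY₁_eq ht]
    exact (oscPos_pos hα hk hpos.le (h.coordY₁_vel_pos hρ) (sub_pos.2 hlt)).le

theorem coordY₂_neg_of_lt (h : PassesCorner θ α k v₂₀ ρ X a T u v) (hsin : 0 ≤ sin θ)
    (hcos : 0 < cos θ) (hρ : ρ < v₂₀ * cos θ) (ht : 0 ≤ t) (htT : t < T) :
    coordY₂ θ (u t) < 0 := by
  rcases lt_or_ge t a with hta | hat
  · obtain ⟨hfst, hsnd⟩ := h.before t ⟨ht, hta⟩
    have hfst_sin := mul_nonneg hfst hsin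
    have hsnd_cos := mul_neg_of_neg_of_pos hsnd hcos
    unfold coordY₂
    linarith
  · exact h.coordY₂_neg hρ ⟨hat, htT⟩

theorem mem_region₂_iff (h : PassesCorner θ α k v₂₀ ρ X a T u v) (hv₂ : 0 < v₂₀)
    (hρ : ρ < v₂₀ * cos θ) (ht : 0 ≤ t) : u t ∈ region₂ θ ↔ a ≤ t ∧ t ≤ T := by
  refine ⟨fun hmem => ⟨?_, ?_⟩, h.mem_region₂ hv₂ hρ⟩
  · by_contra! hlt
    exact (h.before t ⟨ht, hlt⟩).2.not_ge hmem.1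
  · by_contra! hlt
    refine hmem.2.not_gt ?_
    rw [h.coordY₂_eq hlt.le]
    exact mul_pos (sub_pos.2 hlt) (h.coordY₂_vel_pos hρ)

theorem mem_region₃_iff (h : PassesCorner θ α k v₂₀ ρ X a T u v) (hsin : 0 ≤ sin θ)
    (hcos : 0 < cos θ) (hα : 1 < α) (hk : 0 < k) (hpos : 0 < coordY₁ θ (u T))
    (hρ_sin : ρ < v₂₀ * sin θ) (hρ_cos : ρ < v₂₀ * cos θ) (ht : 0 ≤ t) :
    u t ∈ region₃ θ ↔ T ≤ t := by
  refine ⟨fun hmem => ?_, fun hT => ⟨h.coordY₁_nonneg hα hk hpos hρ_sin hT, ?_⟩⟩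
  · by_contra! hlt
    exact (h.coordY₂_neg_of_lt hsin hcos hρ_cos ht hlt).not_ge hmem.2
  · rw [h.coordY₂_eq hT]
    exact mul_nonneg (sub_nonneg.2 hT) (h.coordY₂_vel_pos hρ_cos).le

theorem abs_coordY₂_sub_le (h : PassesCorner θ α k v₂₀ ρ X a T u v) (ht : T ≤ t) :
    |coordY₂ θ (u t) - (t - T) * (v₂₀ * cos θ)| ≤ ρ * (t - T) := by
  have ht_nonneg : 0 ≤ t - T := sub_nonneg.2 ht
  rw [h.coordY₂_eq ht, ← mul_sub, abs_mul, abs_of_nonneg ht_nonneg, mul_comm]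
  exact mul_le_mul_of_nonneg_right (h.isNearlyFree.abs_coordY₂_vel_sub_le θ h.mem_Icc) ht_nonneg

end PassesCorner

theorem CrossesVertexRegion.sqrt_mul_coordY₁_le (h : CrossesVertexRegion θ v₂₀ ρ X a T u v)
    (hX : 0 ≤ X) (hv₂ : 0 ≤ v₂₀) (hρ : ρ ≤ v₂₀) (hX_scaled : √k * X ≤ 1)
    (htime : √k * transitTime θ v₂₀ X ≤ 1 / 4) : √k * coordY₁ θ (u T) ≤ 1 + v₂₀ := by
  have hρ_nonneg : 0 ≤ ρ := (norm_nonneg _).trans (h.isNearlyFree.norm_vel_sub_le T h.mem_Icc)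
  have hnorm : coordY₁ θ (u T) ≤ X + (ρ + v₂₀) * (T - a) :=
    (le_abs_self _).trans ((abs_coordY₁_le θ _).trans (h.isNearlyFree.norm_le hX hv₂ h.mem_Icc))
  calc √k * coordY₁ θ (u T)
    _ ≤ √k * (X + (ρ + v₂₀) * transitTime θ v₂₀ X) := by
      gcongr
      exact hnorm.trans (by gcongr; linarith [h.mem_Icc.2])
    _ = √k * X + (ρ + v₂₀) * (√k * transitTime θ v₂₀ X) := by ring
    _ ≤ 1 + (ρ + v₂₀) * (1 / 4) := by gcongr
    _ ≤ 1 + v₂₀ := by linarith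

theorem IsQuickCrossing.sqrt_mul_transitTime_le (hq : IsQuickCrossing θ α k v₂₀ X D)
    (hα : 1 ≤ α) (hk : 0 ≤ k) (htime : 0 ≤ transitTime θ v₂₀ X) :
    √k * transitTime θ v₂₀ X ≤ 1 / 4 := by
  have hscaled : 0 ≤ √k * transitTime θ v₂₀ X := by positivity
  have hsq : 0 ≤ k * transitTime θ v₂₀ X ^ 2 := by positivity
  linarith [hq.time_le, mul_le_mul_of_nonneg_right hα hscaled]

/-- The constant in the exponential decay of `coordY₁ θ` along the second side of the cone, where
the motion arrives with scaled distance at most `1 + v₂₀` and normal velocity at most `2 v₂₀`. -/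
def decayConst (α v₂₀ : ℝ) : ℝ := (2 * v₂₀ - xi₂ α * (1 + v₂₀)) / (xi₁ α - xi₂ α)

theorem slowAmp_le_decayConst_div (hα : 1 < α) (hk : 0 < k) (hp : √k * p ≤ 1 + v₂₀)
    (hq : q ≤ 2 * v₂₀) : slowAmp α k p q ≤ decayConst α v₂₀ / √k := by
  have hdisc := xi₁_sub_xi₂_pos hα
  have hsqrt : 0 < √k := sqrt_pos.2 hk
  rw [slowAmp, decayConst, div_right_comm]
  gcongr
  rw [le_div_iff₀ hsqrt]
  have hfast := mul_le_mul_of_nonneg_left hp (neg_pos.2 (xi₂_neg hα)).le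
  calc (q / √k - xi₂ α * p) * √k = q + -xi₂ α * (√k * p) := by field_simp; ring
    _ ≤ 2 * v₂₀ - xi₂ α * (1 + v₂₀) := by linarith

theorem PassesCorner.coordY₁_le (h : PassesCorner θ α k v₂₀ ρ X a T u v) (hα : 1 < α) (hk : 0 < k)
    (hv₂ : 0 < v₂₀) (hpos : 0 < coordY₁ θ (u T)) (hscaled : √k * coordY₁ θ (u T) ≤ 1 + v₂₀)
    (hρ : ρ < v₂₀ * sin θ) (ht : T ≤ t) :
    coordY₁ θ (u t) ≤ decayConst α v₂₀ * exp (xi₁ α * (t - T) * √k) / √k := by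
  have hspeed : coordY₁ θ (v T) ≤ 2 * v₂₀ := by
    linarith [(abs_le.1 (h.isNearlyFree.abs_coordY₁_vel_sub_le θ h.mem_Icc)).2,
      mul_le_of_le_one_right hv₂.le (sin_le_one θ)]
  rw [h.coordY₁_eq ht, mul_div_right_comm]
  refine (oscPos_le hα hpos.le (h.coordY₁_vel_pos hρ).le _).trans ?_
  gcongr
  exact slowAmp_le_decayConst_div hα hk hscaled hspeed

end CornerPassage

section PenalizedMotion

variable {θ α k x₂₀ v₁₀ v₂₀ X D : ℝ} {u : ℝ → Plane}

theorem isPenalizedMotion_iff_exists_isMotionOn :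
    IsPenalizedMotion θ α x₂₀ v₁₀ v₂₀ k u ↔ u 0 = !₂[0, x₂₀] ∧ ∃ v : ℝ → Plane,
      v 0 = !₂[v₁₀, v₂₀] ∧ IsMotionOn (penaltyForce θ α k) (Ici 0) u v := by
  refine and_congr_right fun _ => exists_congr fun v => ⟨fun ⟨hv, hu, hforce⟩ => ?_,
    fun ⟨hv₀, h⟩ => ⟨h.continuousOn_vel, h.hasDerivWithinAt, fun t ht => ?_⟩⟩
  · have hv₀ : v 0 = !₂[v₁₀, v₂₀] := by simpa using (hforce 0 le_rfl).2
    exact ⟨hv₀, .of_base 0 hv hu (fun t ht => (hforce t ht).1) fun t ht => hv₀ ▸ (hforce t ht).2⟩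
  · exact ⟨h.intervalIntegrable 0 self_mem_Ici t ht, hv₀ ▸ h.vel_eq 0 self_mem_Ici t ht⟩

/-- The first coordinate at the corner time of the motion along the first side of the cone. -/
def cornerPos (α x₂₀ v₁₀ v₂₀ k : ℝ) : ℝ := oscPos α k 0 v₁₀ (cornerTime x₂₀ v₂₀)

/-- The first component of the velocity at the corner time of the motion along the first side of
the cone. -/
def cornerVel (α x₂₀ v₁₀ v₂₀ k : ℝ) : ℝ := oscVel α k 0 v₁₀ (cornerTime x₂₀ v₂₀)

/-- The bound `crossingDrift` for a motion coming from the first side of the cone. -/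
def cornerDrift (θ α x₂₀ v₁₀ v₂₀ k : ℝ) : ℝ :=
  crossingDrift θ α k v₂₀ (cornerPos α x₂₀ v₁₀ v₂₀ k) (cornerVel α x₂₀ v₁₀ v₂₀ k)

/-- The smallness conditions `IsQuickCrossing` for a motion coming from the first side of the cone.
They hold for large `k`. -/
def IsQuickCorner (θ α x₂₀ v₁₀ v₂₀ k : ℝ) : Prop :=
  IsQuickCrossing θ α k v₂₀ (cornerPos α x₂₀ v₁₀ v₂₀ k) (cornerVel α x₂₀ v₁₀ v₂₀ k)

theorem cornerPos_pos (hα : 1 < α) (hx : x₂₀ < 0) (hv₁ : 0 < v₁₀) (hv₂ : 0 < v₂₀) (hk : 0 < k) :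
    0 < cornerPos α x₂₀ v₁₀ v₂₀ k :=
  oscPos_pos hα hk le_rfl hv₁ (cornerTime_pos hx hv₂)

theorem sidePos_cornerTime (hv₂ : v₂₀ ≠ 0) (α x₂₀ v₁₀ k : ℝ) :
    sidePos 0 α k !₂[0, x₂₀] !₂[v₁₀, v₂₀] (cornerTime x₂₀ v₂₀)
      = !₂[cornerPos α x₂₀ v₁₀ v₂₀ k, 0] := by
  ext i
  fin_cases i
  · simpa [cornerPos] using coordY₁_sidePos 0 α k !₂[0, x₂₀] !₂[v₁₀, v₂₀] (cornerTime x₂₀ v₂₀)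
  · simpa [cornerTime, hv₂] using
      coordY₂_sidePos 0 α k !₂[0, x₂₀] !₂[v₁₀, v₂₀] (cornerTime x₂₀ v₂₀)

theorem sideVel_cornerTime (α x₂₀ v₁₀ v₂₀ k : ℝ) :
    sideVel 0 α k !₂[0, x₂₀] !₂[v₁₀, v₂₀] (cornerTime x₂₀ v₂₀)
      = !₂[cornerVel α x₂₀ v₁₀ v₂₀ k, v₂₀] := by
  ext i
  fin_cases i
  · simpa [cornerVel] using coordY₁_sideVel 0 α k !₂[0, x₂₀] !₂[v₁₀, v₂₀] (cornerTime x₂₀ v₂₀)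
  · simpa using coordY₂_sideVel 0 α k !₂[0, x₂₀] !₂[v₁₀, v₂₀] (cornerTime x₂₀ v₂₀)

theorem IsQuickCorner.exists_isPenalizedMotion (hq : IsQuickCorner θ α x₂₀ v₁₀ v₂₀ k)
    (hsin : 0 < sin θ) (hcos : 0 < cos θ) (hα : 1 < α) (hk : 0 < k) (hx : x₂₀ < 0)
    (hv₁ : 0 < v₁₀) (hv₂ : 0 < v₂₀) : ∃ u, IsPenalizedMotion θ α x₂₀ v₁₀ v₂₀ k u := by
  obtain ⟨p, w, hp, hw, h⟩ := hq.exists_isMotionOn_penaltyForce_Ici hsin hcos hα hk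
    (cornerPos_pos hα hx hv₁ hv₂ hk) hv₂ (cornerTime x₂₀ v₂₀)
  obtain ⟨u, v, hu, hv, h'⟩ := (isMotionOn_penaltyForce_before_corner hsin.le hα hk hv₁
    hv₂).exists_concat (cornerTime_pos hx hv₂).le h ((sidePos_cornerTime hv₂.ne' ..).trans hp.symm)
    ((sideVel_cornerTime ..).trans hw.symm)
  rw [sidePos_zero hα] at hu
  rw [sideVel_zero hα hk] at hv
  exact ⟨u, isPenalizedMotion_iff_exists_isMotionOn.2 ⟨hu, v, hv, h'⟩⟩

theorem IsQuickCorner.exists_passesCorner (hq : IsQuickCorner θ α x₂₀ v₁₀ v₂₀ k)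
    (hsin : 0 < sin θ) (hcos : 0 < cos θ) (hα : 1 < α) (hk : 0 < k) (hx : x₂₀ < 0)
    (hv₁ : 0 < v₁₀) (hv₂ : 0 < v₂₀) (hu : IsPenalizedMotion θ α x₂₀ v₁₀ v₂₀ k u) :
    ∃ T v, HasDerivAt u !₂[cornerVel α x₂₀ v₁₀ v₂₀ k, v₂₀] (cornerTime x₂₀ v₂₀) ∧
      PassesCorner θ α k v₂₀ (cornerDrift θ α x₂₀ v₁₀ v₂₀ k) (cornerPos α x₂₀ v₁₀ v₂₀ k)
        (cornerTime x₂₀ v₂₀) T u v := by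
  obtain ⟨hu₀, v, hv₀, h⟩ := isPenalizedMotion_iff_exists_isMotionOn.1 hu
  have ht₀ := cornerTime_pos hx hv₂
  obtain ⟨hpos, hvel⟩ := (h.mono Icc_subset_Ici_self).eqOn_sidePos_before_corner hsin.le hα hk hx
    hv₁ hv₂ hu₀ hv₀
  have hu_corner := (hpos (right_mem_Icc.2 ht₀.le)).trans (sidePos_cornerTime hv₂.ne' ..)
  have hv_corner := (hvel (right_mem_Icc.2 ht₀.le)).trans (sideVel_cornerTime ..)
  obtain ⟨T, hT, hafter⟩ := hq.exists_crossesVertexRegion_of_isMotionOn hsin hcos hα hk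
    (cornerPos_pos hα hx hv₁ hv₂ hk) hv₂ (h.mono (Ici_subset_Ici.2 ht₀.le)) hu_corner hv_corner
  refine ⟨T, v, hv_corner ▸ (h.hasDerivWithinAt _ ht₀.le).hasDerivAt (Ici_mem_nhds ht₀),
    ⟨hT, fun t ht => ?_, hafter⟩⟩
  rcases ht.1.eq_or_lt with rfl | hpos_t
  · simp [hu₀, hx]
  · rw [hpos (Ico_subset_Icc_self ht)]
    exact (sidePos_mem_before_corner hα hk hv₁ hv₂ ⟨hpos_t, ht.2⟩).imp_left le_of_lt

theorem hasDerivAt_norm {V : Type*} [NormedAddCommGroup V] [InnerProductSpace ℝ V] {f : ℝ → V}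
    {f' : V} {t : ℝ} (hf : HasDerivAt f f' t) (hne : f t ≠ 0) :
    HasDerivAt (fun t => ‖f t‖) (inner ℝ (f t) f' / ‖f t‖) t := by
  have hsqrt := hf.norm_sq.sqrt (pow_ne_zero 2 (norm_ne_zero_iff.2 hne))
  simp only [sqrt_sq (norm_nonneg _)] at hsqrt
  rwa [mul_div_mul_left _ _ two_ne_zero] at hsqrt

theorem energyW_eq (hk : 0 < k) (hX : 0 < X) (hu : u (cornerTime x₂₀ v₂₀) = !₂[X, 0])
    (hderiv : HasDerivAt u !₂[D, v₂₀] (cornerTime x₂₀ v₂₀)) :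
    energyW α x₂₀ v₁₀ v₂₀ k u = (D / etaScale α x₂₀ v₂₀ k) ^ 2
      + constE α v₁₀ v₂₀ / (√k * X / etaScale α x₂₀ v₂₀ k) ^ 2 := by
  have hnorm : ‖u (cornerTime x₂₀ v₂₀)‖ = X := by
    rw [hu, ← sq_eq_sq₀ (norm_nonneg _) hX.le, plane_norm_sq_eq]
    simp
  have hsqrt : √k ≠ 0 := (sqrt_pos.2 hk).ne'
  have hradial : HasDerivAt (fun t => ‖u t‖) D (cornerTime x₂₀ v₂₀) := by
    refine (hasDerivAt_norm hderiv (norm_pos_iff.1 (hnorm ▸ hX))).congr_deriv ?_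
    rw [hnorm, hu, plane_inner_eq]
    simp [hX.ne']
  have hscaled : HasDerivAt (scaledRadius α x₂₀ v₂₀ k u) (D / etaScale α x₂₀ v₂₀ k) 0 := by
    have htime : HasDerivAt (fun τ : ℝ => cornerTime x₂₀ v₂₀ + τ / √k) (1 / √k) 0 :=
      ((hasDerivAt_id (0 : ℝ)).div_const √k).const_add _
    have hcomp : HasDerivAt (fun τ : ℝ => ‖u (cornerTime x₂₀ v₂₀ + τ / √k)‖) (D * (1 / √k)) 0 :=
      HasDerivAt.comp (h₂ := fun t => ‖u t‖) 0 (by simpa using hradial) htime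
    refine ((hcomp.const_mul √k).div_const (etaScale α x₂₀ v₂₀ k)).congr_deriv ?_
    field_simp
  rw [energyW, hscaled.deriv, scaledRadius, zero_div, add_zero, hnorm]

end PenalizedMotion

section CornerExit

variable {θ α k x₂₀ v₁₀ v₂₀ : ℝ} {u : ℝ → Plane}

/-- The motion leaves the region over the vertex for good at the time `T`, with bounds that are
uniform in the stiffness. -/
structure ExitsCornerAt (θ α x₂₀ v₁₀ v₂₀ k T : ℝ) (u : ℝ → Plane) : Prop where
  energyW_eq : energyW α x₂₀ v₁₀ v₂₀ k u = (cornerVel α x₂₀ v₁₀ v₂₀ k / etaScale α x₂₀ v₂₀ k) ^ 2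
    + constE α v₁₀ v₂₀ / (√k * cornerPos α x₂₀ v₁₀ v₂₀ k / etaScale α x₂₀ v₂₀ k) ^ 2
  abs_pos_sub_duration_le :
    |cornerPos α x₂₀ v₁₀ v₂₀ k * sin θ - (T - cornerTime x₂₀ v₂₀) * (v₂₀ * cos θ)|
      ≤ cornerDrift θ α x₂₀ v₁₀ v₂₀ k * (T - cornerTime x₂₀ v₂₀)
  mem_region₂_iff : ∀ t, 0 ≤ t → (u t ∈ region₂ θ ↔ cornerTime x₂₀ v₂₀ ≤ t ∧ t ≤ T)
  mem_region₃_iff : ∀ t, 0 ≤ t → (u t ∈ region₃ θ ↔ T ≤ t)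
  coordY₁_nonneg : ∀ t, T ≤ t → 0 ≤ coordY₁ θ (u t)
  coordY₁_le : ∀ t, T ≤ t → coordY₁ θ (u t) ≤ decayConst α v₂₀ * exp (xi₁ α * (t - T) * √k) / √k
  abs_coordY₂_sub_le : ∀ t, T ≤ t → |coordY₂ θ (u t) - (t - T) * (v₂₀ * cos θ)|
    ≤ cornerDrift θ α x₂₀ v₁₀ v₂₀ k * (t - T)

theorem IsQuickCorner.exists_exitsCornerAt (hq : IsQuickCorner θ α x₂₀ v₁₀ v₂₀ k)
    (hsin : 0 < sin θ) (hcos : 0 < cos θ) (hα : 1 < α) (hk : 0 < k) (hx : x₂₀ < 0)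
    (hv₁ : 0 < v₁₀) (hv₂ : 0 < v₂₀) (hu : IsPenalizedMotion θ α x₂₀ v₁₀ v₂₀ k u) :
    ∃ T, ExitsCornerAt θ α x₂₀ v₁₀ v₂₀ k T u := by
  obtain ⟨T, v, hderiv, h⟩ := hq.exists_passesCorner hsin hcos hα hk hx hv₁ hv₂ hu
  have hX := cornerPos_pos hα hx hv₁ hv₂ hk
  have hρ_cos := hq.drift_lt_cos hcos hv₂
  have hρ_sin := hq.drift_lt_sin hsin hv₂
  have hρ : cornerDrift θ α x₂₀ v₁₀ v₂₀ k ≤ v₂₀ :=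
    hρ_cos.le.trans (mul_le_of_le_one_right hv₂.le (cos_le_one θ))
  have hpos := h.coordY₁_pos hsin hcos hv₂ hX hq.drift_le_cos
  have hscaled := h.sqrt_mul_coordY₁_le hX.le hv₂.le hρ hq.sqrt_mul_pos_le
    (hq.sqrt_mul_transitTime_le hα.le hk.le (transitTime_pos hsin hcos hv₂ hX).le)
  exact ⟨T, {
    energyW_eq := energyW_eq hk hX h.isNearlyFree.start hderiv
    abs_pos_sub_duration_le := h.abs_pos_sub_duration_le
    mem_region₂_iff := fun _ => h.mem_region₂_iff hv₂ hρ_cos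
    mem_region₃_iff := fun _ => h.mem_region₃_iff hsin.le hcos hα hk hpos hρ_sin hρ_cos
    coordY₁_nonneg := fun _ => h.coordY₁_nonneg hα hk hpos hρ_sin
    coordY₁_le := fun _ => h.coordY₁_le hα hk hv₂ hpos hscaled hρ_sin
    abs_coordY₂_sub_le := fun _ => h.abs_coordY₂_sub_le }⟩

theorem IsQuickCorner.exists_exitsCornerAt_add_div (hq : IsQuickCorner θ α x₂₀ v₁₀ v₂₀ k)
    (hsin : 0 < sin θ) (hcos : 0 < cos θ) (hα : 1 < α) (hk : 0 < k) (hx : x₂₀ < 0)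
    (hv₁ : 0 < v₁₀) (hv₂ : 0 < v₂₀) (hu : IsPenalizedMotion θ α x₂₀ v₁₀ v₂₀ k u) :
    ∃ τ, ExitsCornerAt θ α x₂₀ v₁₀ v₂₀ k (cornerTime x₂₀ v₂₀ + τ / √k) u := by
  obtain ⟨T, hT⟩ := hq.exists_exitsCornerAt hsin hcos hα hk hx hv₁ hv₂ hu
  refine ⟨√k * (T - cornerTime x₂₀ v₂₀), ?_⟩
  rwa [mul_div_cancel_left₀ _ (sqrt_pos.2 hk).ne', add_sub_cancel]

end CornerExit

section Asymptotics

theorem tendsto_sqrt_pow_mul_exp {b : ℝ} (hb : b < 0) (n : ℕ) :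
    Tendsto (fun k => √k ^ n * exp (b * √k)) atTop (𝓝 0) := by
  simpa [Function.comp_def] using
    (tendsto_rpow_mul_exp_neg_mul_atTop_nhds_zero n (-b) (neg_pos.2 hb)).comp tendsto_sqrt_atTop

theorem tendsto_exp_mul_sqrt {b : ℝ} (hb : b < 0) :
    Tendsto (fun k => exp (b * √k)) atTop (𝓝 0) := by
  simpa only [pow_zero, one_mul] using tendsto_sqrt_pow_mul_exp hb 0

theorem tendsto_of_abs_sub_le_mul {ι : Type*} {l : Filter ι} {r q ρ : ι → ℝ} {c s d : ℝ}
    (hd : 0 < d) (hq : Tendsto q l (𝓝 c)) (hρ : Tendsto ρ l (𝓝 0))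
    (h : ∀ᶠ i in l, |q i * s - r i * d| ≤ ρ i * r i) : Tendsto r l (𝓝 (c * s / d)) := by
  have hlower : Tendsto (fun i => q i * s / (d + ρ i)) l (𝓝 (c * s / d)) := by
    have hlim := (hq.mul_const s).div (hρ.const_add d) (by simpa using hd.ne')
    rwa [add_zero] at hlim
  have hupper : Tendsto (fun i => q i * s / (d - ρ i)) l (𝓝 (c * s / d)) := by
    have hlim := (hq.mul_const s).div (hρ.const_sub d) (by simpa using hd.ne')
    rwa [sub_zero] at hlim
  refine tendsto_of_tendsto_of_tendsto_of_le_of_le' hlower hupper ?_ ?_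
  · filter_upwards [h, hρ.eventually_const_lt (neg_lt_zero.2 hd)] with i hi hρi
    rw [div_le_iff₀ (by linarith)]
    linarith [(abs_le.1 hi).2]
  · filter_upwards [h, hρ.eventually_lt_const hd] with i hi hρi
    rw [le_div_iff₀ (by linarith)]
    linarith [(abs_le.1 hi).1]

variable {θ α k x₂₀ v₁₀ v₂₀ : ℝ}

theorem sqrt_mul_cornerPos (hk : 0 < k) (α x₂₀ v₁₀ v₂₀ : ℝ) :
    √k * cornerPos α x₂₀ v₁₀ v₂₀ k = v₁₀ / (xi₁ α - xi₂ α) *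
      (exp (xi₁ α * cornerTime x₂₀ v₂₀ * √k) - exp (xi₂ α * cornerTime x₂₀ v₂₀ * √k)) := by
  have hsqrt : √k ≠ 0 := (sqrt_pos.2 hk).ne'
  simp only [cornerPos, oscPos, slowAmp, fastAmp, mul_zero, sub_zero, zero_sub]
  field_simp
  ring

theorem cornerVel_eq (hk : 0 < k) (α x₂₀ v₁₀ v₂₀ : ℝ) :
    cornerVel α x₂₀ v₁₀ v₂₀ k = v₁₀ / (xi₁ α - xi₂ α) *
      (xi₁ α * exp (xi₁ α * cornerTime x₂₀ v₂₀ * √k)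
        - xi₂ α * exp (xi₂ α * cornerTime x₂₀ v₂₀ * √k)) := by
  have hsqrt : √k ≠ 0 := (sqrt_pos.2 hk).ne'
  simp only [cornerVel, oscVel, slowAmp, fastAmp, mul_zero, sub_zero, zero_sub]
  field_simp
  ring

theorem etaScale_sq (α x₂₀ v₂₀ k : ℝ) :
    etaScale α x₂₀ v₂₀ k ^ 2 = exp (xi₁ α * cornerTime x₂₀ v₂₀ * √k) := by
  rw [etaScale, ← exp_nat_mul]
  congr 1
  push_cast
  ring

theorem sqrt_constE (hα : 1 < α) (hv₁ : 0 < v₁₀) (hv₂ : 0 < v₂₀) :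
    √(constE α v₁₀ v₂₀) = v₁₀ / (xi₁ α - xi₂ α) * v₂₀ := by
  have hdisc := sqrt_disc_pos hα
  rw [xi₁_sub_xi₂, sqrt_eq_iff_mul_self_eq_of_pos (by positivity), constE]
  have hsq : √(α ^ 2 - 1) ^ 2 = α ^ 2 - 1 := sq_sqrt (sqrt_pos.1 hdisc).le
  have hdisc_ne : α ^ 2 - 1 ≠ 0 := (sqrt_pos.1 hdisc).ne'
  field_simp
  rw [hsq]
  ring

theorem tendsto_sqrt_pow_mul_cornerPos (hα : 1 < α) (hx : x₂₀ < 0) (v₁₀ : ℝ) (hv₂ : 0 < v₂₀)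
    (n : ℕ) : Tendsto (fun k => √k ^ n * cornerPos α x₂₀ v₁₀ v₂₀ k) atTop (𝓝 0) := by
  have ht₀ := cornerTime_pos hx hv₂
  have hmodes := ((tendsto_sqrt_pow_mul_exp (mul_neg_of_neg_of_pos (xi₁_neg hα) ht₀) n).sub
    (tendsto_sqrt_pow_mul_exp (mul_neg_of_neg_of_pos (xi₂_neg hα) ht₀) n)).const_mul
      (v₁₀ / (xi₁ α - xi₂ α))
  have hlim := (tendsto_inv_atTop_zero.comp tendsto_sqrt_atTop).mul hmodes
  rw [zero_mul] at hlim
  refine hlim.congr' ?_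
  filter_upwards [eventually_gt_atTop 0] with k hk
  have hsqrt : √k ≠ 0 := (sqrt_pos.2 hk).ne'
  rw [Function.comp_apply, ← mul_sub, mul_left_comm (v₁₀ / _), ← sqrt_mul_cornerPos hk]
  field_simp

theorem tendsto_cornerVel (hα : 1 < α) (hx : x₂₀ < 0) (v₁₀ : ℝ) (hv₂ : 0 < v₂₀) :
    Tendsto (cornerVel α x₂₀ v₁₀ v₂₀) atTop (𝓝 0) := by
  have ht₀ := cornerTime_pos hx hv₂
  have hmodes := (((tendsto_exp_mul_sqrt (mul_neg_of_neg_of_pos (xi₁_neg hα) ht₀)).const_mul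
    (xi₁ α)).sub ((tendsto_exp_mul_sqrt (mul_neg_of_neg_of_pos (xi₂_neg hα) ht₀)).const_mul
      (xi₂ α))).const_mul (v₁₀ / (xi₁ α - xi₂ α))
  simp only [mul_zero, sub_zero] at hmodes
  refine hmodes.congr' ?_
  filter_upwards [eventually_gt_atTop 0] with k hk using (cornerVel_eq hk α x₂₀ v₁₀ v₂₀).symm

theorem tendsto_sqrt_pow_mul_transitTime_cornerPos (θ : ℝ) (hα : 1 < α) (hx : x₂₀ < 0) (v₁₀ : ℝ)
    (hv₂ : 0 < v₂₀) (n : ℕ) :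
    Tendsto (fun k => √k ^ n * transitTime θ v₂₀ (cornerPos α x₂₀ v₁₀ v₂₀ k)) atTop (𝓝 0) := by
  have hlim := (tendsto_sqrt_pow_mul_cornerPos hα hx v₁₀ hv₂ n).const_mul (2 * tan θ / v₂₀)
  rw [mul_zero] at hlim
  refine hlim.congr fun k => ?_
  rw [transitTime]
  ring

theorem driftBound_mul_sqrt (hk : 0 ≤ k) (c h r s : ℝ) : driftBound (c * √k) k h r s =
    √k * h * ((c + √k * h) * (2 * (s + √k * h * (√k * r))) + √k * r) := by
  have hsq : √k ^ 2 = k := sq_sqrt hk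
  rw [driftBound]
  generalize √k = m at hsq ⊢
  subst hsq
  ring

theorem tendsto_cornerDrift (θ : ℝ) (hα : 1 < α) (hx : x₂₀ < 0) (v₁₀ : ℝ) (hv₂ : 0 < v₂₀) :
    Tendsto (cornerDrift θ α x₂₀ v₁₀ v₂₀) atTop (𝓝 0) := by
  have htime := tendsto_sqrt_pow_mul_transitTime_cornerPos θ hα hx v₁₀ hv₂ 1
  have hpos := tendsto_sqrt_pow_mul_cornerPos hα hx v₁₀ hv₂ 1
  have hvel := (tendsto_cornerVel hα hx v₁₀ hv₂).abs
  have hlim := (htime.mul (((htime.const_add (2 * α)).mul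
    (((hvel.add_const v₂₀).add (htime.mul hpos)).const_mul 2)).add hpos)).add hvel
  simp only [zero_mul, abs_zero, zero_add] at hlim
  refine hlim.congr' ?_
  filter_upwards [eventually_ge_atTop 0] with k hk
  simp only [cornerDrift, crossingDrift, driftBound_mul_sqrt hk, pow_one]

theorem tendsto_existenceTime (θ : ℝ) (hα : 1 < α) (hx : x₂₀ < 0) (v₁₀ : ℝ) (hv₂ : 0 < v₂₀) :
    Tendsto (fun k => (|cornerVel α x₂₀ v₁₀ v₂₀ k| + v₂₀ + 1 +
      (2 * α * √k * (|cornerVel α x₂₀ v₁₀ v₂₀ k| + v₂₀ + 1) +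
        k * (cornerPos α x₂₀ v₁₀ v₂₀ k + 1))) *
      transitTime θ v₂₀ (cornerPos α x₂₀ v₁₀ v₂₀ k)) atTop (𝓝 0) := by
  have htime := tendsto_sqrt_pow_mul_transitTime_cornerPos θ hα hx v₁₀ hv₂
  have hpos := tendsto_sqrt_pow_mul_cornerPos hα hx v₁₀ hv₂ 0
  have hspeed := ((tendsto_cornerVel hα hx v₁₀ hv₂).abs.add_const v₂₀).add_const 1
  have hlim := ((hspeed.mul (htime 0)).add ((hspeed.const_mul (2 * α)).mul (htime 1))).add
    ((hpos.add_const 1).mul (htime 2))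
  simp only [mul_zero, add_zero] at hlim
  refine hlim.congr' ?_
  filter_upwards [eventually_ge_atTop 0] with k hk
  rw [sq_sqrt hk]
  ring

theorem eventually_isQuickCorner (hsin : 0 < sin θ) (hcos : 0 < cos θ) (hα : 1 < α) (hx : x₂₀ < 0)
    (v₁₀ : ℝ) (hv₂ : 0 < v₂₀) : ∀ᶠ k in atTop, IsQuickCorner θ α x₂₀ v₁₀ v₂₀ k := by
  have htime := tendsto_sqrt_pow_mul_transitTime_cornerPos θ hα hx v₁₀ hv₂ 1
  have hdrift := tendsto_cornerDrift θ hα hx v₁₀ hv₂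
  have hgrowth := htime.mul (htime.const_add (2 * α))
  rw [zero_mul] at hgrowth
  filter_upwards [eventually_ge_atTop 0, hgrowth.eventually_le_const one_half_pos,
    hdrift.eventually_le_const (by positivity : 0 < v₂₀ * cos θ / 4),
    hdrift.eventually_le_const (by positivity : 0 < v₂₀ * sin θ / 4),
    (tendsto_sqrt_pow_mul_cornerPos hα hx v₁₀ hv₂ 1).eventually_le_const one_pos,
    (tendsto_existenceTime θ hα hx v₁₀ hv₂).eventually_le_const one_pos]
    with k hk hgrowth_k hdrift_cos hdrift_sin hpos hexistence
  refine ⟨?_, hdrift_cos, hdrift_sin, by simpa only [pow_one] using hpos, hexistence⟩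
  rw [pow_one] at hgrowth_k
  refine hgrowth_k.trans_eq' ?_
  linear_combination transitTime θ v₂₀ (cornerPos α x₂₀ v₁₀ v₂₀ k) ^ 2 * sq_sqrt hk

theorem tendsto_sqrt_mul_cornerPos_div (hα : 1 < α) (hx : x₂₀ < 0) (v₁₀ : ℝ) (hv₂ : 0 < v₂₀) :
    Tendsto (fun k => √k * cornerPos α x₂₀ v₁₀ v₂₀ k / etaScale α x₂₀ v₂₀ k ^ 2) atTop
      (𝓝 (v₁₀ / (xi₁ α - xi₂ α))) := by
  have hgap : (xi₂ α - xi₁ α) * cornerTime x₂₀ v₂₀ < 0 :=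
    mul_neg_of_neg_of_pos (sub_neg.2 (sub_pos.1 (xi₁_sub_xi₂_pos hα))) (cornerTime_pos hx hv₂)
  have hlim := ((tendsto_exp_mul_sqrt hgap).const_sub 1).const_mul (v₁₀ / (xi₁ α - xi₂ α))
  rw [sub_zero, mul_one] at hlim
  refine hlim.congr' ?_
  filter_upwards [eventually_gt_atTop 0] with k hk
  rw [sqrt_mul_cornerPos hk, etaScale_sq, mul_div_assoc, sub_div, div_self (exp_ne_zero _),
    ← exp_sub]
  ring_nf

theorem tendsto_energyW_mul_etaScale_sq (hα : 1 < α) (hx : x₂₀ < 0) (hv₁ : 0 < v₁₀)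
    (hv₂ : 0 < v₂₀) {T : ℝ → ℝ} {u : ℝ → ℝ → Plane}
    (h : ∀ᶠ k in atTop, ExitsCornerAt θ α x₂₀ v₁₀ v₂₀ k (T k) (u k)) :
    Tendsto (fun k => energyW α x₂₀ v₁₀ v₂₀ k (u k) * etaScale α x₂₀ v₂₀ k ^ 2) atTop
      (𝓝 (v₂₀ ^ 2)) := by
  have hamp : 0 < v₁₀ / (xi₁ α - xi₂ α) := div_pos hv₁ (xi₁_sub_xi₂_pos hα)
  have hE : constE α v₁₀ v₂₀ = (v₁₀ / (xi₁ α - xi₂ α) * v₂₀) ^ 2 := by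
    rw [← sqrt_constE hα hv₁ hv₂, sq_sqrt]
    have hdisc := sqrt_pos.1 (sqrt_disc_pos hα)
    unfold constE
    positivity
  have hlim := ((tendsto_cornerVel hα hx v₁₀ hv₂).pow 2).add
    (((tendsto_const_nhds (x := constE α v₁₀ v₂₀)).div
      ((tendsto_sqrt_mul_cornerPos_div hα hx v₁₀ hv₂).pow 2)) (pow_ne_zero 2 hamp.ne'))
  have hvalue : (0 : ℝ) ^ 2 + constE α v₁₀ v₂₀ / (v₁₀ / (xi₁ α - xi₂ α)) ^ 2 = v₂₀ ^ 2 := by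
    rw [hE, mul_pow, mul_div_cancel_left₀ _ (pow_ne_zero 2 hamp.ne'), zero_pow two_ne_zero,
      zero_add]
  rw [hvalue] at hlim
  refine hlim.congr' ?_
  filter_upwards [h, eventually_gt_atTop 0] with k hexit hk
  have hη : etaScale α x₂₀ v₂₀ k ≠ 0 := exp_ne_zero _
  have hX := (cornerPos_pos hα hx hv₁ hv₂ hk).ne'
  have hsqrt : √k ≠ 0 := (sqrt_pos.2 hk).ne'
  rw [hexit.energyW_eq]
  simp only [Pi.div_apply]
  field_simp

/-- The limit of the scaled time that the motion spends over the vertex, divided by `η ^ 2`. -/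
def exitTimeLimit (θ α v₁₀ v₂₀ : ℝ) : ℝ := v₁₀ / (xi₁ α - xi₂ α) * sin θ / (v₂₀ * cos θ)

theorem tendsto_exitTime_div (hcos : 0 < cos θ) (hα : 1 < α) (hx : x₂₀ < 0) (hv₂ : 0 < v₂₀)
    {τ : ℝ → ℝ} {u : ℝ → ℝ → Plane}
    (h : ∀ᶠ k in atTop, ExitsCornerAt θ α x₂₀ v₁₀ v₂₀ k (cornerTime x₂₀ v₂₀ + τ k / √k) (u k)) :
    Tendsto (fun k => τ k / etaScale α x₂₀ v₂₀ k ^ 2) atTop (𝓝 (exitTimeLimit θ α v₁₀ v₂₀)) := by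
  refine tendsto_of_abs_sub_le_mul (mul_pos hv₂ hcos)
    (tendsto_sqrt_mul_cornerPos_div hα hx v₁₀ hv₂) (tendsto_cornerDrift θ hα hx v₁₀ hv₂) ?_
  filter_upwards [h, eventually_gt_atTop 0] with k hexit hk
  have hη : etaScale α x₂₀ v₂₀ k ≠ 0 := exp_ne_zero _
  have hsqrt : √k ≠ 0 := (sqrt_pos.2 hk).ne'
  have hscale : 0 ≤ √k / etaScale α x₂₀ v₂₀ k ^ 2 := by positivity
  have hexit_time := hexit.abs_pos_sub_duration_le
  rw [add_sub_cancel_left] at hexit_time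
  calc |√k * cornerPos α x₂₀ v₁₀ v₂₀ k / etaScale α x₂₀ v₂₀ k ^ 2 * sin θ
        - τ k / etaScale α x₂₀ v₂₀ k ^ 2 * (v₂₀ * cos θ)|
    _ = |√k / etaScale α x₂₀ v₂₀ k ^ 2 *
        (cornerPos α x₂₀ v₁₀ v₂₀ k * sin θ - τ k / √k * (v₂₀ * cos θ))| := by
      congr 1
      field_simp
    _ = √k / etaScale α x₂₀ v₂₀ k ^ 2 *
        |cornerPos α x₂₀ v₁₀ v₂₀ k * sin θ - τ k / √k * (v₂₀ * cos θ)| := by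
      rw [abs_mul, abs_of_nonneg hscale]
    _ ≤ √k / etaScale α x₂₀ v₂₀ k ^ 2 * (cornerDrift θ α x₂₀ v₁₀ v₂₀ k * (τ k / √k)) := by gcongr
    _ = cornerDrift θ α x₂₀ v₁₀ v₂₀ k * (τ k / etaScale α x₂₀ v₂₀ k ^ 2) := by field_simp

theorem tendsto_div_energyW_div (hcos : 0 < cos θ) (hα : 1 < α) (hx : x₂₀ < 0) (hv₁ : 0 < v₁₀)
    (hv₂ : 0 < v₂₀) {T : ℝ → ℝ} {u : ℝ → ℝ → Plane}
    (h : ∀ᶠ k in atTop, ExitsCornerAt θ α x₂₀ v₁₀ v₂₀ k (T k) (u k)) :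
    Tendsto (fun k => tan θ * √(constE α v₁₀ v₂₀) / energyW α x₂₀ v₁₀ v₂₀ k (u k)
      / etaScale α x₂₀ v₂₀ k ^ 2) atTop (𝓝 (exitTimeLimit θ α v₁₀ v₂₀)) := by
  have hlim := (tendsto_const_nhds (x := tan θ * √(constE α v₁₀ v₂₀))).div
    (tendsto_energyW_mul_etaScale_sq hα hx hv₁ hv₂ h) (pow_ne_zero 2 hv₂.ne')
  have hvalue : tan θ * √(constE α v₁₀ v₂₀) / v₂₀ ^ 2 = exitTimeLimit θ α v₁₀ v₂₀ := by
    rw [sqrt_constE hα hv₁ hv₂, tan_eq_sin_div_cos, exitTimeLimit]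
    field_simp
  rw [hvalue] at hlim
  exact hlim.congr fun k => (div_div _ _ _).symm

theorem exitTime_isEquivalent (hsin : 0 < sin θ) (hcos : 0 < cos θ) (hα : 1 < α) (hx : x₂₀ < 0)
    (hv₁ : 0 < v₁₀) (hv₂ : 0 < v₂₀) {τ : ℝ → ℝ} {u : ℝ → ℝ → Plane}
    (h : ∀ᶠ k in atTop, ExitsCornerAt θ α x₂₀ v₁₀ v₂₀ k (cornerTime x₂₀ v₂₀ + τ k / √k) (u k)) :
    τ ~[atTop] fun k => tan θ * √(constE α v₁₀ v₂₀) / energyW α x₂₀ v₁₀ v₂₀ k (u k) := by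
  have hgap := xi₁_sub_xi₂_pos hα
  have hlimit : exitTimeLimit θ α v₁₀ v₂₀ ≠ 0 := by
    unfold exitTimeLimit
    positivity
  have hratio := (tendsto_exitTime_div hcos hα hx hv₂ h).div
    (tendsto_div_energyW_div hcos hα hx hv₁ hv₂ h) hlimit
  rw [div_self hlimit] at hratio
  refine isEquivalent_of_tendsto_one (hratio.congr fun k => ?_)
  exact div_div_div_cancel_right₀ (pow_ne_zero 2 (exp_ne_zero _)) _ _

theorem exitTime_isBigO (hcos : 0 < cos θ) (hα : 1 < α) (hx : x₂₀ < 0) (hv₂ : 0 < v₂₀)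
    {τ : ℝ → ℝ} {u : ℝ → ℝ → Plane}
    (h : ∀ᶠ k in atTop, ExitsCornerAt θ α x₂₀ v₁₀ v₂₀ k (cornerTime x₂₀ v₂₀ + τ k / √k) (u k)) :
    τ =O[atTop] fun k => etaScale α x₂₀ v₂₀ k ^ 2 :=
  isBigO_of_div_tendsto_nhds (.of_forall fun _ hη => absurd hη (pow_ne_zero 2 (exp_ne_zero _))) _
    (tendsto_exitTime_div hcos hα hx hv₂ h)

theorem eventually_abs_coordY₂_sub_le (hcos : 0 < cos θ) (hα : 1 < α) (hx : x₂₀ < 0)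
    (hv₂ : 0 < v₂₀) {T : ℝ → ℝ} {u : ℝ → ℝ → Plane}
    (h : ∀ᶠ k in atTop, ExitsCornerAt θ α x₂₀ v₁₀ v₂₀ k (T k) (u k)) {ε : ℝ} (hε : 0 < ε) :
    ∀ᶠ k in atTop, ∀ t, T k ≤ t →
      |coordY₂ θ (u k t) - (t - T k) * v₂₀ * cos θ| ≤ ε * ((t - T k) * v₂₀ * cos θ) := by
  filter_upwards [h, (tendsto_cornerDrift θ hα hx v₁₀ hv₂).eventually_le_const
    (mul_pos hε (mul_pos hv₂ hcos))] with k hexit hdrift t ht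
  rw [mul_assoc]
  calc |coordY₂ θ (u k t) - (t - T k) * (v₂₀ * cos θ)|
    _ ≤ cornerDrift θ α x₂₀ v₁₀ v₂₀ k * (t - T k) := hexit.abs_coordY₂_sub_le t ht
    _ ≤ ε * (v₂₀ * cos θ) * (t - T k) := by gcongr
    _ = ε * ((t - T k) * (v₂₀ * cos θ)) := by ring

end Asymptotics

end

theorem mainTheorem3 (θ α x₂₀ v₁₀ v₂₀ : ℝ) (hθ₀ : 0 < θ) (hθ : θ < π / 2) (hα : 1 < α)
    (hx : x₂₀ < 0) (hv₁ : 0 < v₁₀) (hv₂ : 0 < v₂₀) :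
    (∀ᶠ k in atTop, ∃ u : ℝ → Plane, IsPenalizedMotion θ α x₂₀ v₁₀ v₂₀ k u) ∧
    ∃ C : ℝ, ∀ u : ℝ → ℝ → Plane,
      (∀ᶠ k in atTop, IsPenalizedMotion θ α x₂₀ v₁₀ v₂₀ k (u k)) →
      ∃ τbar tbar : ℝ → ℝ,
        (∀ k, tbar k = cornerTime x₂₀ v₂₀ + τbar k / √k) ∧
        -- the point is in the vertex region exactly until `tbar`, in the third region afterwards
        (∀ᶠ k in atTop, ∀ t, 0 ≤ t →
          (u k t ∈ region₂ θ ↔ cornerTime x₂₀ v₂₀ ≤ t ∧ t ≤ tbar k) ∧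
          (u k t ∈ region₃ θ ↔ tbar k ≤ t)) ∧
        (τbar ~[atTop] fun k => tan θ * √(constE α v₁₀ v₂₀) / energyW α x₂₀ v₁₀ v₂₀ k (u k)) ∧
        (τbar =O[atTop] fun k => etaScale α x₂₀ v₂₀ k ^ 2) ∧
        (∀ᶠ k in atTop, ∀ t, tbar k ≤ t →
          0 ≤ coordY₁ θ (u k t) ∧
          coordY₁ θ (u k t) ≤ C * exp (xi₁ α * (t - tbar k) * √k) / √k) ∧
        -- the equivalence of `y₂` holds uniformly in `t`
        (∀ ε : ℝ, 0 < ε → ∀ᶠ k in atTop, ∀ t, tbar k ≤ t →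
          |coordY₂ θ (u k t) - (t - tbar k) * v₂₀ * cos θ| ≤ ε * ((t - tbar k) * v₂₀ * cos θ)) := by
  have hsin : 0 < sin θ := sin_pos_of_pos_of_lt_pi hθ₀ (by linarith [pi_pos])
  have hcos : 0 < cos θ := cos_pos_of_mem_Ioo ⟨by linarith [pi_pos], hθ⟩
  have hquick := (eventually_isQuickCorner hsin hcos hα hx v₁₀ hv₂).and (eventually_gt_atTop 0)
  refine ⟨hquick.mono fun k ⟨hq, hk⟩ => hq.exists_isPenalizedMotion hsin hcos hα hk hx hv₁ hv₂,
    decayConst α v₂₀, fun u hu => ?_⟩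
  obtain ⟨τ, hexit⟩ := ((hquick.and hu).mono fun k ⟨⟨hq, hk⟩, hu_k⟩ =>
    hq.exists_exitsCornerAt_add_div hsin hcos hα hk hx hv₁ hv₂ hu_k).choice
  exact ⟨τ, fun k => cornerTime x₂₀ v₂₀ + τ k / √k, fun _ => rfl,
    hexit.mono fun k h t ht => ⟨h.mem_region₂_iff t ht, h.mem_region₃_iff t ht⟩,
    exitTime_isEquivalent hsin hcos hα hx hv₁ hv₂ hexit,
    exitTime_isBigO hcos hα hx hv₂ hexit,
    hexit.mono fun k h t ht => ⟨h.coordY₁_nonneg t ht, h.coordY₁_le t ht⟩,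
    fun ε hε => eventually_abs_coordY₂_sub_le hcos hα hx hv₂ hexit hε⟩
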